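/- Let $R$ be an associative unital ring. For a module $M$, let $\mathrm{soc}(M)$ be the sum of its simple submodules, $\mathrm{top}(M)=M/\mathrm{rad}(M)$ with $\mathrm{rad}(M)$ the intersection of all maximal submodules (so $\mathrm{top}(R)=R/J(R)$ on either side), and let ${}_R\mathcal L(M)$, respectively $\mathcal L_R(M)$, be the lattice of submodules of a left, respectively right, $R$-module $M$. Put $S_r=\mathrm{soc}(R_R)$ and $S_l=\mathrm{soc}({}_RR)$, and for $X\subseteq R$ put $l(X)=\{a\in R: aX=0\}$ and $r(X)=\{a\in R: Xa=0\}$. An idempotent $e$ is local if $\mathrm{End}_R(eR)$ is a local ring. Let $R$ be a semiperfect ring, i.e. $1=f_1+\dots+f_m$ with pairwise orthogonal local idempotents $f_i$, and assume that $S_r$ is an essential right ideal and $S_l$ is an essential left ideal. Let $e_1,\dots,e_n$ be any basic set of idempotents of $R$, i.e. idempotents chosen from such a family $f_1,\dots,f_m$ so that each $f_iR$ is isomorphic to exactly one of $e_1R,\dots,e_nR$. **Theorem.** (a) $R$ has a Nakayama permutation, i.e. there is a permutation $\pi$ of $\{1,\dots,n\}$ with $$\mathrm{soc}(e_kR)\cong\mathrm{top}(e_{\pi(k)}R)\quad\text{and}\quad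 \mathrm{soc}(Re_{\pi(k)})\cong\mathrm{top}(Re_k)\qquad\text{for all }k\le n,$$ if and only if there exist lattice anti-isomorphisms $${}_R\mathcal L(\mathrm{top}(R))\cong_{op}\mathcal L_R(S_r)\quad\text{and}\quad {}_R\mathcal L(S_l)\cong_{op}\mathcal L_R(\mathrm{top}(R)).$$ (b) If there exist any lattice anti-isomorphisms of these two kinds, then there exist ones given by annihilators: identifying the submodules of $\mathrm{top}(R)$ with the one-sided ideals of $R$ containing $J(R)$, the maps $r$ and $l$ induce mutually inverse lattice anti-isomorphisms between ${}_R\mathcal L(\mathrm{top}(R))$ and $\mathcal L_R(S_r)$, and also between ${}_R\mathcal L(S_l)$ and $\mathcal L_R(\mathrm{top}(R))$. -/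

import Mathlib

/-! Rings are associative and unital, not necessarily commutative.  Left `R`-modules are `R`-modules,
right `R`-modules are `Rᵐᵒᵖ`-modules; so left ideals are elements of `Submodule R R` and right ideals
are elements of `Submodule Rᵐᵒᵖ R`. -/

universe u v

namespace SemiperfectRing

section Modules

variable (R : Type u) [Ring R] (M : Type v) [AddCommGroup M] [Module R M]

/-- The socle of a module: the sum of its simple submodules. -/
def socle : Submodule R M := sSup {N : Submodule R M | IsSimpleModule R N}

/-- The top of a module: its quotient by its radical, where the radical is the intersection of all
maximal submodules.  For `M = R` as a left or a right module over itself, the radical is the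
Jacobson radical `J(R)`; for `M = eR` with `e` idempotent it is `eJ(R)`, and for `M = Re` it is
`J(R)e`. -/
abbrev Top : Type v := M ⧸ Module.jacobson R M

variable {R M}

/-- A submodule is essential if it meets every nonzero submodule nontrivially. -/
def IsEssential (N : Submodule R M) : Prop := ∀ K : Submodule R M, K ≠ ⊥ → N ⊓ K ≠ ⊥

end Modules

section Rings

variable {R : Type u} [Ring R]

/-- The principal right ideal `aR`. -/
abbrev rightIdeal (a : R) : Submodule Rᵐᵒᵖ R := Submodule.span Rᵐᵒᵖ {a}

/-- The principal left ideal `Ra`. -/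
abbrev leftIdeal (a : R) : Submodule R R := Submodule.span R {a}

/-- A local idempotent: the endomorphism ring of the right module `eR` is local. -/
def IsLocalIdempotent (e : R) : Prop :=
  IsIdempotentElem e ∧ IsLocalRing (Module.End Rᵐᵒᵖ (rightIdeal e))

/-- `f₁, …, f_m` are pairwise orthogonal local idempotents with sum `1`. -/
def IsLocalDecomposition {m : ℕ} (f : Fin m → R) : Prop :=
  CompleteOrthogonalIdempotents f ∧ ∀ i, IsLocalIdempotent (f i)

variable (R) in
/-- A semiperfect ring: its unity is a sum of finitely many pairwise orthogonal local
idempotents. -/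
def IsSemiperfectRing : Prop := ∃ (m : ℕ) (f : Fin m → R), IsLocalDecomposition f

/-- A basic set of idempotents: members `e₁, …, e_n` of a complete family `f₁, …, f_m` of pairwise
orthogonal local idempotents, such that each right ideal `f_i R` is isomorphic to exactly one of
`e₁R, …, e_nR`. -/
def IsBasicSet {n : ℕ} (e : Fin n → R) : Prop :=
  ∃ (m : ℕ) (f : Fin m → R), IsLocalDecomposition f ∧ (∀ k, ∃ i, e k = f i) ∧
    ∀ i, ∃! k, Nonempty (rightIdeal (e k) ≃ₗ[Rᵐᵒᵖ] rightIdeal (f i))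

/-- Every semiperfect ring has a basic set of idempotents. -/
theorem IsSemiperfectRing.exists_isBasicSet (hR : IsSemiperfectRing R) :
    ∃ (n : ℕ) (e : Fin n → R), IsBasicSet e := by
  classical
  obtain ⟨m, f, hf⟩ := hR
  let s : Setoid (Fin m) :=
    { r := fun i j => Nonempty (rightIdeal (f i) ≃ₗ[Rᵐᵒᵖ] rightIdeal (f j))
      iseqv := ⟨fun _ => ⟨LinearEquiv.refl _ _⟩, fun ⟨h⟩ => ⟨h.symm⟩,
        fun ⟨h⟩ ⟨h'⟩ => ⟨h.trans h'⟩⟩ }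
  let q : Fin (Fintype.card (Quotient s)) ≃ Quotient s := (Fintype.equivFin _).symm
  refine ⟨_, fun k => f (q k).out, m, f, hf, fun k => ⟨_, rfl⟩, fun i => ?_⟩
  refine ⟨q.symm (Quotient.mk s i), ?_, fun k hk => ?_⟩
  · have h : s ((q (q.symm (Quotient.mk s i))).out) i := by
      rw [Equiv.apply_symm_apply]
      exact Quotient.mk_out i
    exact h
  · have h : s ((q k).out) i := hk
    rw [Equiv.eq_symm_apply, ← Quotient.out_eq (q k)]
    exact Quotient.sound h

/-- `π` is a Nakayama permutation with respect to the basic set of idempotents `e₁, …, e_n`: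
`soc(e_k R) ≅ top(e_{π(k)} R)` as right modules and `soc(R e_{π(k)}) ≅ top(R e_k)` as left modules,
for all `k`. -/
def IsNakayamaPermutation {n : ℕ} (e : Fin n → R) (π : Equiv.Perm (Fin n)) : Prop :=
  ∀ k,
    Nonempty (socle Rᵐᵒᵖ (rightIdeal (e k)) ≃ₗ[Rᵐᵒᵖ] Top Rᵐᵒᵖ (rightIdeal (e (π k)))) ∧
    Nonempty (socle R (leftIdeal (e (π k))) ≃ₗ[R] Top R (leftIdeal (e k)))

/-- The left annihilator `l(X) = {a | aX = 0}` of a subset of the ring, a left ideal. -/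
def leftAnnihilator (X : Set R) : Submodule R R where
  carrier := {a | ∀ x ∈ X, a * x = 0}
  add_mem' ha hb x hx := by rw [add_mul, ha x hx, hb x hx, add_zero]
  zero_mem' x _ := zero_mul x
  smul_mem' c a ha x hx := by rw [smul_eq_mul, mul_assoc, ha x hx, mul_zero]

/-- The right annihilator `r(X) = {a | Xa = 0}` of a subset of the ring, a right ideal. -/
def rightAnnihilator (X : Set R) : Submodule Rᵐᵒᵖ R where
  carrier := {a | ∀ x ∈ X, x * a = 0}
  add_mem' ha hb x hx := by rw [mul_add, ha x hx, hb x hx, add_zero]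
  zero_mem' x _ := mul_zero x
  smul_mem' c a ha x hx := by
    rw [← MulOpposite.op_unop c, op_smul_eq_mul, ← mul_assoc, ha x hx, zero_mul]

variable (R)

/-- Lattice anti-isomorphisms from the left submodules of `top(R)` to the right submodules of the
right socle `S_r`. -/
abbrev TopSocleAntiIso : Type u :=
  Submodule R (Top R R) ≃o (Submodule Rᵐᵒᵖ (socle Rᵐᵒᵖ R))ᵒᵈ

/-- Lattice anti-isomorphisms from the left submodules of the left socle `S_l` to the right
submodules of `top(R)`. -/
abbrev SocleTopAntiIso : Type u :=
  Submodule R (socle R R) ≃o (Submodule Rᵐᵒᵖ (Top Rᵐᵒᵖ R))ᵒᵈ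

variable {R}

/-- The anti-isomorphism `φ` and its inverse are induced by `r` and `l`, where a submodule of
`top(R)` is identified with its preimage in `R`, an ideal containing `J(R)`, and a submodule of
`S_r` with an ideal contained in `S_r`. -/
def TopSocleAntiIso.IsInducedByAnnihilators (φ : TopSocleAntiIso R) : Prop :=
  (∀ N : Submodule R (Top R R),
    (OrderDual.ofDual (φ N)).map (socle Rᵐᵒᵖ R).subtype =
      rightAnnihilator (N.comap (Module.jacobson R R).mkQ : Set R)) ∧
  (∀ K : Submodule Rᵐᵒᵖ (socle Rᵐᵒᵖ R),
    (φ.symm (OrderDual.toDual K)).comap (Module.jacobson R R).mkQ =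
      leftAnnihilator (K.map (socle Rᵐᵒᵖ R).subtype : Set R))

/-- The anti-isomorphism `ψ` and its inverse are induced by `r` and `l`, with the same
identifications for `S_l` and the right module `top(R)`. -/
def SocleTopAntiIso.IsInducedByAnnihilators (ψ : SocleTopAntiIso R) : Prop :=
  (∀ K : Submodule R (socle R R),
    (OrderDual.ofDual (ψ K)).comap (Module.jacobson Rᵐᵒᵖ R).mkQ =
      rightAnnihilator (K.map (socle R R).subtype : Set R)) ∧
  (∀ N : Submodule Rᵐᵒᵖ (Top Rᵐᵒᵖ R),
    (ψ.symm (OrderDual.toDual N)).map (socle R R).subtype =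
      leftAnnihilator (N.comap (Module.jacobson Rᵐᵒᵖ R).mkQ : Set R))

end Rings

end SemiperfectRing

open SemiperfectRing

/-! Both directions pass through one condition, `HasSimpleSocles`: the right socle of each `eₖR` and
the left socle of each `Reₖ` is zero or simple, every simple right module occurs in `S_r`, and every
simple left module in `S_l`. Over a semiperfect ring `S_r` and `S_l` consist of the `x` with `xJ =
0`, respectively `Jx = 0`, so this is a condition on elements. A Nakayama permutation gives it at
once.

Under this condition, essentiality forces `S_r = S_l` (`rightKills_iff_leftKills`). A nonzero
element of `eₖS_r` can then be cut down to `eₖS_r e_j`. The resulting map `k ↦ j` is injective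
because the left socle of `Re_j` is simple, so it is a permutation, and the same elements witness
the right and left conditions (`exists_perm`).

The condition also yields the double annihilator equalities. If `N ⊇ J` is a left ideal and `y ∉ N`,
some simple quotient of `R/N` does not kill `y`; it embeds in `S_l`, which gives an element of
`r(N)` not annihilated by `y`. For a right ideal `K ⊆ S_r`, the equality `rl(K) = K` is proved by
adding one generator at a time.

Conversely, let anti-isomorphisms be given. Since `top(R)` has length `m`, so has `S_r`, the direct
sum of the `m` pieces `fᵢS_r`; these are nonzero by essentiality, hence simple. For the occurrence
of all types, maximal submodules of `top(R)` with quotients of the `n` different types correspond to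
simple submodules of `S_r`. Two distinct simple submodules are isomorphic only if their sum contains
a third, and dually the quotients by two maximal submodules are isomorphic if a third lies above
their intersection. So different types go to different types, and by finiteness all occur. -/

namespace SemiperfectRing

/-! ### The Jacobson radical and its left-right symmetry -/

section Jacobson

variable {A : Type*} [Ring A]

/-- The inverse of `1 - ba` is `1 + b(1 - ab)⁻¹a`. -/
theorem isUnit_one_sub_mul_comm {a b : A} (h : IsUnit (1 - a * b)) : IsUnit (1 - b * a) := by
  obtain ⟨u, hu⟩ := h
  have h1 : (1 - a * b) * (↑u⁻¹ : A) = 1 := by rw [← hu, Units.mul_inv]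
  have h2 : (↑u⁻¹ : A) * (1 - a * b) = 1 := by rw [← hu, Units.inv_mul]
  refine ⟨⟨1 - b * a, 1 + b * ↑u⁻¹ * a, ?_, ?_⟩, rfl⟩
  · calc (1 - b * a) * (1 + b * ↑u⁻¹ * a)
        = 1 - b * a + b * ((1 - a * b) * ↑u⁻¹) * a := by noncomm_ring
      _ = 1 := by rw [h1]; noncomm_ring
  · calc (1 + b * ↑u⁻¹ * a) * (1 - b * a)
        = 1 - b * a + b * (↑u⁻¹ * (1 - a * b)) * a := by noncomm_ring
      _ = 1 := by rw [h2]; noncomm_ring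

theorem mem_jacobson_iff_isUnit_left {x : A} :
    x ∈ Ring.jacobson A ↔ ∀ y, IsUnit (1 - y * x) := by
  rw [← Ideal.jacobson_bot, Ideal.mem_jacobson_iff]
  constructor
  · intro h y
    obtain ⟨z, hz⟩ := h (-y)
    have hz1 : z * (1 - y * x) = 1 := by
      have := sub_eq_zero.1 ((Submodule.mem_bot A).1 hz)
      calc z * (1 - y * x) = z * -y * x + z := by noncomm_ring
        _ = 1 := this
    -- The left inverse `z` equals `1 + zyx`, which has the same form, so it has a left inverse too
    -- and is a unit.
    obtain ⟨w, hw⟩ := h (z * y)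
    have hw1 : w * z = 1 := by
      have h3 := sub_eq_zero.1 ((Submodule.mem_bot A).1 hw)
      have h4 : z = z * y * x + 1 := by
        calc z = z * (1 - y * x) + z * y * x := by noncomm_ring
          _ = _ := by rw [hz1, add_comm]
      calc w * z = w * (z * y * x + 1) := by rw [← h4]
        _ = w * (z * y) * x + w := by noncomm_ring
        _ = 1 := h3
    have h5 : w = 1 - y * x := by
      calc w = w * (z * (1 - y * x)) := by rw [hz1, mul_one]
        _ = 1 - y * x := by rw [← mul_assoc, hw1, one_mul]
    exact ⟨⟨1 - y * x, z, h5 ▸ hw1, hz1⟩, rfl⟩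
  · intro h y
    obtain ⟨u, hu⟩ := h (-y)
    refine ⟨↑u⁻¹, (Submodule.mem_bot A).2 (sub_eq_zero.2 ?_)⟩
    calc (↑u⁻¹ : A) * y * x + ↑u⁻¹ = ↑u⁻¹ * (1 - -y * x) := by noncomm_ring
      _ = 1 := by rw [← hu, Units.inv_mul]

theorem mem_jacobson_iff_isUnit_right {x : A} :
    x ∈ Ring.jacobson A ↔ ∀ y, IsUnit (1 - x * y) := by
  rw [mem_jacobson_iff_isUnit_left]
  exact ⟨fun h y => isUnit_one_sub_mul_comm (h y), fun h y => isUnit_one_sub_mul_comm (h y)⟩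

theorem op_mem_jacobson_iff {x : A} :
    MulOpposite.op x ∈ Ring.jacobson Aᵐᵒᵖ ↔ x ∈ Ring.jacobson A := by
  rw [mem_jacobson_iff_isUnit_left, mem_jacobson_iff_isUnit_right]
  constructor
  · intro h y
    have := h (MulOpposite.op y)
    rw [← MulOpposite.op_mul, ← MulOpposite.op_one, ← MulOpposite.op_sub] at this
    exact isUnit_op.1 this
  · intro h y
    have := h y.unop
    rw [← isUnit_op] at this
    simpa using this

theorem mem_jacobson_op_iff {x : Aᵐᵒᵖ} :
    x ∈ Ring.jacobson Aᵐᵒᵖ ↔ x.unop ∈ Ring.jacobson A :=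
  op_mem_jacobson_iff (x := x.unop)

theorem mem_right_jacobson_iff {x : A} :
    x ∈ Module.jacobson Aᵐᵒᵖ A ↔ x ∈ Ring.jacobson A := by
  rw [← op_mem_jacobson_iff, Ring.jacobson,
    ← Module.comap_jacobson_of_bijective (f := (MulOpposite.opLinearEquiv Aᵐᵒᵖ :
      A ≃ₗ[Aᵐᵒᵖ] Aᵐᵒᵖ).toLinearMap) (MulOpposite.opLinearEquiv Aᵐᵒᵖ).bijective]
  rfl

theorem mul_mem_jacobson_right {x : A} (h : x ∈ Ring.jacobson A) (y : A) :
    x * y ∈ Ring.jacobson A := Ideal.mul_mem_right _ _ h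

theorem mul_mem_jacobson_left {x : A} (h : x ∈ Ring.jacobson A) (y : A) :
    y * x ∈ Ring.jacobson A := Ideal.mul_mem_left _ _ h

end Jacobson

/-! ### Local idempotents and their simple tops -/

section LocalIdempotents

variable {A : Type*} [Ring A]

/-- An idempotent outside the Jacobson radical that is generated, on either side, by every element
of `eA`, respectively `Ae`, outside the radical. -/
structure IsTopSimple (e : A) : Prop where
  idem : e * e = e
  notMem : e ∉ Ring.jacobson A
  exists_right : ∀ x, e * x ∉ Ring.jacobson A → ∃ r, e * x * r = e
  exists_left : ∀ x, x * e ∉ Ring.jacobson A → ∃ r, r * (x * e) = e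

theorem IsTopSimple.op {e : A} (h : IsTopSimple e) : IsTopSimple (MulOpposite.op e) where
  idem := by rw [← MulOpposite.op_mul, h.idem]
  notMem := by rw [op_mem_jacobson_iff]; exact h.notMem
  exists_right x hx := by
    rw [mem_jacobson_op_iff] at hx
    obtain ⟨r, hr⟩ := h.exists_left x.unop hx
    exact ⟨MulOpposite.op r, MulOpposite.unop_injective hr⟩
  exists_left x hx := by
    rw [mem_jacobson_op_iff] at hx
    obtain ⟨r, hr⟩ := h.exists_right x.unop hx
    exact ⟨MulOpposite.op r, MulOpposite.unop_injective hr⟩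

theorem self_mem_rightIdeal (e : A) : e ∈ rightIdeal e := Submodule.mem_span_singleton_self e

theorem mem_rightIdeal_iff {e x : A} : x ∈ rightIdeal e ↔ ∃ r, e * r = x := by
  rw [Submodule.mem_span_singleton]
  exact ⟨fun ⟨a, h⟩ => ⟨a.unop, h⟩, fun ⟨r, h⟩ => ⟨MulOpposite.op r, h⟩⟩

theorem mem_rightIdeal_iff_of_idem {e x : A} (he : e * e = e) : x ∈ rightIdeal e ↔ e * x = x := by
  rw [mem_rightIdeal_iff]
  exact ⟨fun ⟨r, h⟩ => by rw [← h, ← mul_assoc, he], fun h => ⟨x, h⟩⟩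

theorem mem_leftIdeal_iff_of_idem {e x : A} (he : e * e = e) : x ∈ leftIdeal e ↔ x * e = x := by
  rw [Submodule.mem_span_singleton]
  exact ⟨fun ⟨r, h⟩ => by rw [← h, smul_eq_mul, mul_assoc, he], fun h => ⟨x, h⟩⟩

/-- Left multiplication by an element of `fAe` as a map `eA → fA`. -/
def mulLeftHom {e f : A} (a : A) (h : f * (a * e) = a * e) :
    rightIdeal e →ₗ[Aᵐᵒᵖ] rightIdeal f where
  toFun x := ⟨a * x, by
    obtain ⟨r, hr⟩ := mem_rightIdeal_iff.1 x.2
    exact mem_rightIdeal_iff.2 ⟨a * x, by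
      rw [← hr, ← mul_assoc a, ← mul_assoc f, h]⟩⟩
  map_add' x y := Subtype.ext (mul_add a _ _)
  map_smul' r x := Subtype.ext (by
    change a * ((x : A) * r.unop) = a * x * r.unop
    rw [mul_assoc])

theorem apply_eq_mul {e f : A} (he : e * e = e) (g : rightIdeal e →ₗ[Aᵐᵒᵖ] rightIdeal f)
    (x : rightIdeal e) : (g x : A) = g ⟨e, self_mem_rightIdeal e⟩ * x := by
  have : x = MulOpposite.op (x : A) • (⟨e, self_mem_rightIdeal e⟩ : rightIdeal e) :=
    Subtype.ext ((mem_rightIdeal_iff_of_idem he).1 x.2).symm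
  conv_lhs => rw [this, map_smul]
  rfl

/-- An endomorphism of `eA` is left multiplication by the image of `e`; the inverse endomorphism
supplies `y` as its value at `e`. -/
theorem exists_corner_inverse {e x : A} (he : e * e = e) (hx : e * x * e = x)
    (hu : IsUnit (mulLeftHom (e := e) (f := e) x
      (by rw [← hx]; simp only [mul_assoc, he]; simp only [← mul_assoc, he]))) :
    ∃ y, e * y = y ∧ y * e = y ∧ x * y = e ∧ y * x = e := by
  set g := mulLeftHom (e := e) (f := e) x
    (by rw [← hx]; simp only [mul_assoc, he]; simp only [← mul_assoc, he]) with hg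
  obtain ⟨u, hu⟩ := hu
  set h : Module.End Aᵐᵒᵖ (rightIdeal e) := (↑u⁻¹ : Module.End Aᵐᵒᵖ (rightIdeal e))
  have h1 : ∀ z, g (h z) = z := fun z => by
    have : (g * h) z = z := by rw [← hu, Units.mul_inv]; rfl
    exact this
  have h2 : ∀ z, h (g z) = z := fun z => by
    have : (h * g) z = z := by rw [← hu, Units.inv_mul]; rfl
    exact this
  let E : rightIdeal e := ⟨e, self_mem_rightIdeal e⟩
  have hxe : x * e = x := by rw [← hx, mul_assoc _ e e, he]
  have hex : e * x = x := by rw [← hx, ← mul_assoc, ← mul_assoc, he]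
  refine ⟨h E, (mem_rightIdeal_iff_of_idem he).1 (h E).2, ?_, congrArg Subtype.val (h1 E), ?_⟩
  · exact (apply_eq_mul he h E).symm
  · rw [← apply_eq_mul he h ⟨x, (mem_rightIdeal_iff_of_idem he).2 hex⟩]
    have : (⟨x, (mem_rightIdeal_iff_of_idem he).2 hex⟩ : rightIdeal e) = g E :=
      Subtype.ext hxe.symm
    rw [this, h2]

/-- The two multiplications, by `exe` and by `e - exe`, add up to the identity of `eA`, so one of
them is invertible in the local ring `End(eA)`. -/
theorem IsLocalIdempotent.corner {e : A} (h : IsLocalIdempotent e) (x : A) :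
    (∃ y, e * y = y ∧ y * e = y ∧ e * x * e * y = e ∧ y * (e * x * e) = e) ∨
    (∃ y, e * y = y ∧ y * e = y ∧ (e - e * x * e) * y = e ∧ y * (e - e * x * e) = e) := by
  obtain ⟨he, hl⟩ := h
  have he : e * e = e := he
  have a1 : e * (e * x * e) * e = e * x * e := by
    simp only [mul_assoc, he]; simp only [← mul_assoc, he]
  have a2 : e * (e - e * x * e) * e = e - e * x * e := by
    rw [mul_sub, sub_mul, a1, he, he]
  have b1 : e * (e * x * e * e) = e * x * e * e := by
    simp only [mul_assoc, he]; simp only [← mul_assoc, he]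
  have b2 : e * ((e - e * x * e) * e) = (e - e * x * e) * e := by
    rw [← mul_assoc, a2, sub_mul, he, mul_assoc _ e e, he]
  have key := hl.isUnit_or_isUnit_of_add_one (a := mulLeftHom (e := e) (f := e) _ b1)
    (b := mulLeftHom (e := e) (f := e) _ b2) (by
      ext z
      change e * x * e * z + (e - e * x * e) * z = z
      rw [← add_mul, add_sub_cancel, (mem_rightIdeal_iff_of_idem he).1 z.2])
  rcases key with k | k
  · exact Or.inl (exists_corner_inverse he a1 k)
  · exact Or.inr (exists_corner_inverse he a2 k)

/-- The corner inverse `y` is completed by the identity on the complement: the inverse is `1 - e +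
y`. -/
theorem isUnit_one_sub_corner {e x y : A} (he : e * e = e) (h1 : e * y = y) (h2 : y * e = y)
    (h3 : (e - e * x * e) * y = e) (h4 : y * (e - e * x * e) = e) :
    IsUnit (1 - e * x * e) := by
  have h5 : e * x * e * y = y - e := by
    rw [sub_mul, h1] at h3
    exact eq_sub_iff_add_eq'.2 (sub_eq_iff_eq_add.1 h3).symm
  have h6 : y * (e * x * e) = y - e := by
    rw [mul_sub, h2] at h4
    exact eq_sub_iff_add_eq'.2 (sub_eq_iff_eq_add.1 h4).symm
  have h7 : e * x * e * e = e * x * e := by rw [mul_assoc _ e e, he]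
  have h8 : e * (e * x * e) = e * x * e := by rw [← mul_assoc, ← mul_assoc, he]
  refine ⟨⟨1 - e * x * e, 1 - e + y, ?_, ?_⟩, rfl⟩
  · calc (1 - e * x * e) * (1 - e + y)
        = 1 - e + y - e * x * e + e * x * e * e - e * x * e * y := by noncomm_ring
      _ = 1 := by rw [h5, h7]; abel
  · calc (1 - e + y) * (1 - e * x * e)
        = 1 - e + y - e * x * e + e * (e * x * e) - y * (e * x * e) := by noncomm_ring
      _ = 1 := by rw [h6, h8]; abel

/-- If `ex` does not generate `e`, no `exye` is invertible in `eAe`. Then every `e - exye` is, so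
every `1 - exy` is a unit and `ex` lies in the radical. -/
theorem IsLocalIdempotent.isTopSimple {e : A} (h : IsLocalIdempotent e) : IsTopSimple e := by
  have he : e * e = e := h.1
  refine ⟨he, fun hJ => ?_, fun x hx => ?_, fun x hx => ?_⟩
  · have hu := mem_jacobson_iff_isUnit_left.1 hJ 1
    rw [one_mul] at hu
    have h0 : e = 0 := by
      obtain ⟨u, hu⟩ := hu
      rw [← Units.mul_right_eq_zero u, hu, sub_mul, one_mul, he, sub_self]
    have := h.2
    obtain ⟨z, hz⟩ := exists_ne (0 : Module.End Aᵐᵒᵖ (rightIdeal e))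
    refine hz (LinearMap.ext fun y => Subtype.ext ?_)
    rw [apply_eq_mul he]
    have hy := (mem_rightIdeal_iff_of_idem he).1 y.2
    have hy0 : (y : A) = 0 := by rw [← hy]; simp [h0]
    rw [hy0, mul_zero]; rfl
  · by_contra hn
    refine hx (mem_jacobson_iff_isUnit_right.2 fun y => ?_)
    rcases h.corner (x * y) with ⟨z, -, -, h3, -⟩ | ⟨z, h1, h2, h3, h4⟩
    · exact absurd ⟨y * e * z, by
        calc e * x * (y * e * z) = e * (x * y) * e * z := by noncomm_ring
          _ = e := h3⟩ hn
    · have := isUnit_one_sub_corner he h1 h2 h3 h4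
      have := isUnit_one_sub_mul_comm (a := e * (x * y)) (b := e) this
      rwa [← mul_assoc, he, ← mul_assoc] at this
  · by_contra hn
    refine hx (mem_jacobson_iff_isUnit_left.2 fun y => ?_)
    rcases h.corner (y * x) with ⟨z, -, -, -, h3⟩ | ⟨z, h1, h2, h3, h4⟩
    · exact absurd ⟨z * e * y, by
        calc z * e * y * (x * e) = z * (e * (y * x) * e) := by noncomm_ring
          _ = e := h3⟩ hn
    · have := isUnit_one_sub_corner he h1 h2 h3 h4
      rw [mul_assoc] at this
      have := isUnit_one_sub_mul_comm this
      rwa [mul_assoc, he, mul_assoc] at this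

end LocalIdempotents

/-! ### Basic families of idempotents -/

section BasicFamilies

variable {A : Type*} [Ring A] {m n : ℕ}

/-- A complete orthogonal family `f` of idempotents with simple tops, together with a
subfamily `e` that represents each of their isomorphism classes once. -/
structure IsBasicFamily (f : Fin m → A) (e : Fin n → A) : Prop where
  complete : CompleteOrthogonalIdempotents f
  topSimple : ∀ i, IsTopSimple (f i)
  exists_eq : ∀ k, ∃ i, e k = f i
  exists_factor : ∀ i, ∃ k a b, a * e k * b = f i
  eq_of_notMem : ∀ k j a, e k * a * e j ∉ Ring.jacobson A → k = j

theorem IsBasicFamily.topSimple' {f : Fin m → A} {e : Fin n → A} (h : IsBasicFamily f e)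
    (k : Fin n) : IsTopSimple (e k) := by
  obtain ⟨i, hi⟩ := h.exists_eq k
  rw [hi]; exact h.topSimple i

/-- The conditions are self-dual, so one-sided results carry over to the other side through the
opposite ring. -/
theorem IsBasicFamily.op {f : Fin m → A} {e : Fin n → A} (h : IsBasicFamily f e) :
    IsBasicFamily (fun i => MulOpposite.op (f i)) (fun k => MulOpposite.op (e k)) where
  complete :=
    { idem := fun i => (h.topSimple i).op.idem
      ortho := fun i j hij => by
        change MulOpposite.op (f i) * MulOpposite.op (f j) = 0
        rw [← MulOpposite.op_mul, h.complete.ortho hij.symm, MulOpposite.op_zero]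
      complete := by
        rw [← Finset.op_sum, h.complete.complete, MulOpposite.op_one] }
  topSimple i := (h.topSimple i).op
  exists_eq k := (h.exists_eq k).imp fun i hi => by rw [hi]
  exists_factor i := by
    obtain ⟨k, a, b, hab⟩ := h.exists_factor i
    exact ⟨k, .op b, .op a, by rw [← hab, ← MulOpposite.op_mul, ← MulOpposite.op_mul, mul_assoc]⟩
  eq_of_notMem k j a ha := by
    rw [mem_jacobson_op_iff] at ha
    exact (h.eq_of_notMem j k a.unop (by simpa [mul_assoc] using ha)).symm

theorem IsBasicSet.exists_isBasicFamily {e : Fin n → A} (h : IsBasicSet e) :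
    ∃ (m : ℕ) (f : Fin m → A), IsBasicFamily f e := by
  obtain ⟨m, f, hf, hef, hu⟩ := h
  have hP : ∀ i, IsTopSimple (f i) := fun i => (hf.2 i).isTopSimple
  have hPe : ∀ k, IsTopSimple (e k) := fun k => by
    obtain ⟨i, hi⟩ := hef k
    rw [hi]; exact hP i
  refine ⟨m, f, hf.1, hP, hef, fun i => ?_, fun k j a ha => ?_⟩
  · obtain ⟨k, ⟨φ⟩, -⟩ := hu i
    let E : rightIdeal (e k) := ⟨e k, self_mem_rightIdeal _⟩
    let F : rightIdeal (f i) := ⟨f i, self_mem_rightIdeal _⟩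
    refine ⟨k, φ E, φ.symm F, ?_⟩
    have h1 := apply_eq_mul (hPe k).idem φ.toLinearMap (φ.symm F)
    simp only [LinearEquiv.coe_coe, LinearEquiv.apply_symm_apply] at h1
    rw [mul_assoc, (mem_rightIdeal_iff_of_idem (hPe k).idem).1 (φ.symm F).2]
    exact h1.symm
  · obtain ⟨i, hi⟩ := hef k
    refine (hu i).unique (hi ▸ ⟨LinearEquiv.refl _ _⟩) ?_
    rw [← hi]
    obtain ⟨b, hb⟩ := (hPe k).exists_right (a * e j) (by rwa [← mul_assoc])
    obtain ⟨c, hc⟩ := (hPe j).exists_left (e k * a) ha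
    have hk := (hPe k).idem
    have hj := (hPe j).idem
    have h1 : e k * (e k * a * e j) = e k * a * e j := by simp only [← mul_assoc, hk]
    rw [← mul_assoc] at hb
    -- The right inverse `b` and the left inverse `c` of `eₖae_j` agree between the corners, so left
    -- multiplication by `eₖae_j` is an isomorphism `e_jA ≅ eₖA`.
    have hcb : c * e k = e j * b := by
      calc c * e k = c * (e k * a * e j * b) := by rw [hb]
        _ = c * (e k * a * e j) * b := by noncomm_ring
        _ = e j * b := by rw [hc]
    refine ⟨LinearEquiv.ofLinearMap (mulLeftHom (e k * a * e j) (by rw [mul_assoc _ (e j), hj, h1]))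
      (mulLeftHom (e j * b) ?_) ?_ ?_⟩
    · simp only [← mul_assoc, hj]
    · ext z
      change e k * a * e j * (e j * b * z) = z
      rw [← (mem_rightIdeal_iff_of_idem hk).1 z.2]
      calc e k * a * e j * (e j * b * (e k * z)) = e k * a * (e j * e j) * b * e k * z := by noncomm_ring
        _ = _ := by rw [hj, hb, hk]
    · ext z
      change e j * b * (e k * a * e j * z) = z
      rw [← hcb]
      calc c * e k * (e k * a * e j * z) = c * ((e k * e k) * a * e j) * z := by noncomm_ring
        _ = _ := by rw [hk, hc, (mem_rightIdeal_iff_of_idem hj).1 z.2]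

end BasicFamilies

/-! ### Simple modules detected by an idempotent -/

section SimpleModules

variable {A : Type*} [Ring A] {M X Y : Type*} [AddCommGroup M] [Module A M]
  [AddCommGroup X] [Module A X] [AddCommGroup Y] [Module A Y]

theorem isSimpleModule_iff_exists_smul_eq :
    IsSimpleModule A M ↔ (∃ x : M, x ≠ 0) ∧ ∀ x y : M, x ≠ 0 → ∃ a : A, a • x = y := by
  rw [isSimpleModule_iff_toSpanSingleton_surjective, nontrivial_iff_exists_ne (0 : M)]
  exact and_congr Iff.rfl ⟨fun h x y hx => h x hx y, fun h x hx y => h x y hx⟩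

theorem jacobson_smul_eq_zero [IsSimpleModule A X] {j : A} (hj : j ∈ Ring.jacobson A) (x : X) :
    j • x = 0 :=
  Module.mem_annihilator.1 (IsSemisimpleModule.jacobson_le_annihilator A X hj) x

/-- If `ax = aεx ≠ 0`, then `aε` is outside the radical, so some `r` has `raε = ε` and `rax = x`. -/
theorem isSimpleModule_span_singleton {ε : A} (hε : IsTopSimple ε) {x : M} (hx : ε • x = x)
    (hx0 : x ≠ 0) (hJ : ∀ j ∈ Ring.jacobson A, j • x = 0) :
    IsSimpleModule A (Submodule.span A {x}) := by
  rw [isSimpleModule_iff_exists_smul_eq]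
  refine ⟨⟨⟨x, Submodule.mem_span_singleton_self x⟩, fun h => hx0 (congrArg Subtype.val h)⟩, ?_⟩
  rintro ⟨y, hy⟩ ⟨z, hz⟩ hy0
  obtain ⟨a, rfl⟩ := Submodule.mem_span_singleton.1 hy
  obtain ⟨b, rfl⟩ := Submodule.mem_span_singleton.1 hz
  have ha : a * ε ∉ Ring.jacobson A := fun h => hy0 (Subtype.ext (by
    change a • x = 0
    rw [← hx, ← mul_smul, hJ _ h]))
  obtain ⟨r, hr⟩ := hε.exists_left a ha
  refine ⟨b * r, Subtype.ext ?_⟩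
  change (b * r) • a • x = b • x
  conv_lhs => rw [← hx]
  rw [← mul_smul, ← mul_smul, mul_assoc, mul_assoc, hr, mul_smul, hx]

/-- The annihilator of `εx` depends on `ε` alone, so `ε` determines the simple modules on which it
acts nontrivially. -/
theorem ker_toSpanSingleton_smul {ε : A} (hε : IsTopSimple ε) [IsSimpleModule A X] {x : X}
    (hx : ε • x ≠ 0) (a : A) :
    a ∈ LinearMap.ker (LinearMap.toSpanSingleton A X (ε • x)) ↔ a * ε ∈ Ring.jacobson A := by
  rw [LinearMap.mem_ker, LinearMap.toSpanSingleton_apply, ← mul_smul]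
  constructor
  · intro h
    by_contra hn
    obtain ⟨r, hr⟩ := hε.exists_left a hn
    apply hx
    rw [← hr, mul_smul, h, smul_zero]
  · exact fun h => jacobson_smul_eq_zero h x

theorem nonempty_equiv_of_smul_ne_zero {ε : A} (hε : IsTopSimple ε) [IsSimpleModule A X]
    [IsSimpleModule A Y] {x : X} (hx : ε • x ≠ 0) {y : Y} (hy : ε • y ≠ 0) :
    Nonempty (X ≃ₗ[A] Y) := by
  have hk : LinearMap.ker (LinearMap.toSpanSingleton A X (ε • x)) =
      LinearMap.ker (LinearMap.toSpanSingleton A Y (ε • y)) := by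
    ext a
    rw [ker_toSpanSingleton_smul hε hx, ker_toSpanSingleton_smul hε hy]
  exact ⟨((LinearMap.quotKerEquivOfSurjective _
      (IsSimpleModule.toSpanSingleton_surjective A hx)).symm.trans
    (Submodule.quotEquivOfEq _ _ hk)).trans (LinearMap.quotKerEquivOfSurjective _
      (IsSimpleModule.toSpanSingleton_surjective A hy))⟩

/-- A nonzero cyclic module is not its own radical; modulo the radical, any nonzero class recovers
the generator as in `isSimpleModule_span_singleton`. -/
theorem isSimpleModule_top_span {ε : A} (hε : IsTopSimple ε) {c : M} (hc : ε • c = c)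
    (hc0 : c ≠ 0) : IsSimpleModule A (Top A (Submodule.span A {c})) := by
  set C := Submodule.span A {c} with hC
  let c' : C := ⟨c, Submodule.mem_span_singleton_self c⟩
  have : Nontrivial C := ⟨⟨c', 0, fun h => hc0 (congrArg Subtype.val h)⟩⟩
  have hlt : Module.jacobson A C < ⊤ := Module.jacobson_lt_top A C
  have hgen : ∀ y : C, ∃ a : A, a • c' = y := fun y => by
    obtain ⟨a, ha⟩ := Submodule.mem_span_singleton.1 y.2
    exact ⟨a, Subtype.ext ha⟩
  have hc' : ε • c' = c' := Subtype.ext hc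
  rw [isSimpleModule_iff_exists_smul_eq]
  constructor
  · obtain ⟨x, -, hx⟩ := SetLike.exists_of_lt hlt
    exact ⟨Submodule.Quotient.mk x, fun h => hx ((Submodule.Quotient.mk_eq_zero _).1 h)⟩
  · intro x y hx
    obtain ⟨x, rfl⟩ := Submodule.Quotient.mk_surjective _ x
    obtain ⟨y, rfl⟩ := Submodule.Quotient.mk_surjective _ y
    obtain ⟨a, rfl⟩ := hgen x
    obtain ⟨b, rfl⟩ := hgen y
    have ha : a * ε ∉ Ring.jacobson A := fun h => hx ((Submodule.Quotient.mk_eq_zero _).2 (by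
      rw [← hc', ← mul_smul]
      exact Ring.jacobson_smul_top_le A C
        (Submodule.smul_mem_smul h Submodule.mem_top)))
    obtain ⟨r, hr⟩ := hε.exists_left a ha
    refine ⟨b * r, ?_⟩
    rw [← Submodule.Quotient.mk_smul]
    congr 1
    conv_lhs => rw [← hc']
    rw [← mul_smul, ← mul_smul, mul_assoc, mul_assoc, hr, mul_smul, hc']

end SimpleModules

/-! ### Socles over a ring with a basic family -/

section BasicFamilyModules

variable {A : Type*} [Ring A] {m n : ℕ} {f : Fin m → A} {e : Fin n → A}
  {M X : Type*} [AddCommGroup M] [Module A M] [AddCommGroup X] [Module A X]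

theorem IsBasicFamily.sum_smul (h : IsBasicFamily f e) (x : M) : ∑ i, f i • x = x := by
  rw [← Finset.sum_smul, h.complete.complete, one_smul]

theorem IsBasicFamily.exists_smul_ne_zero (h : IsBasicFamily f e) {x : M} (hx : x ≠ 0) :
    ∃ i, f i • x ≠ 0 := by
  by_contra! hn
  exact hx (by rw [← h.sum_smul x, Finset.sum_eq_zero fun i _ => hn i])

theorem IsBasicFamily.exists_basic_smul_ne_zero (h : IsBasicFamily f e) {x : M} (hx : x ≠ 0) :
    ∃ (k : Fin n) (b : A), e k • b • x ≠ 0 := by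
  obtain ⟨i, hi⟩ := h.exists_smul_ne_zero hx
  obtain ⟨k, a, b, hab⟩ := h.exists_factor i
  refine ⟨k, b, fun h0 => hi ?_⟩
  rw [← hab, mul_smul, mul_smul, h0, smul_zero]

theorem IsBasicFamily.eq_of_smul_ne_zero (h : IsBasicFamily f e) [IsSimpleModule A X] {k j : Fin n}
    {x y : X} (hx : e k • x ≠ 0) (hy : e j • y ≠ 0) : k = j := by
  obtain ⟨a, ha⟩ := (isSimpleModule_iff_exists_smul_eq.1 ‹IsSimpleModule A X›).2 (e k • x) (e j • y) hx
  refine (h.eq_of_notMem j k a fun hJ => hy ?_).symm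
  have : (e j * a * e k) • x = 0 := jacobson_smul_eq_zero hJ x
  rw [mul_smul, mul_smul, ha, ← mul_smul, (h.topSimple' j).idem] at this
  exact this

/-- The radical kills simple modules. Conversely `x = ∑ fᵢx`, and if the radical kills `x`, each
`fᵢx` is zero or generates a simple module. -/
theorem IsBasicFamily.mem_socle_iff (h : IsBasicFamily f e) {x : M} :
    x ∈ socle A M ↔ ∀ j ∈ Ring.jacobson A, j • x = 0 := by
  constructor
  · intro hx
    let K : Submodule A M :=
      { carrier := {x | ∀ j ∈ Ring.jacobson A, j • x = 0}
        add_mem' := fun ha hb j hj => by rw [smul_add, ha j hj, hb j hj, add_zero]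
        zero_mem' := fun j _ => smul_zero j
        smul_mem' := fun c a ha j hj => by
          rw [← mul_smul]; exact ha _ (mul_mem_jacobson_right hj c) }
    have hle : socle A M ≤ K := sSup_le fun N hN y hy j hj => by
      have : IsSimpleModule A N := hN
      exact congrArg Subtype.val (jacobson_smul_eq_zero hj (⟨y, hy⟩ : N))
    exact hle hx
  · intro hx
    rw [← h.sum_smul x]
    refine Submodule.sum_mem _ fun i _ => ?_
    by_cases h0 : f i • x = 0
    · rw [h0]; exact zero_mem _
    · have hs := isSimpleModule_span_singleton (h.topSimple i) (x := f i • x)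
        (by rw [← mul_smul, (h.topSimple i).idem]) h0
        (fun j hj => by rw [← mul_smul]; exact hx _ (mul_mem_jacobson_right hj _))
      exact le_sSup (α := Submodule A M) (a := Submodule.span A {f i • x}) hs
        (Submodule.mem_span_singleton_self _)

theorem IsBasicFamily.mem_socle_submodule_iff (h : IsBasicFamily f e) {N : Submodule A M} {x : N} :
    x ∈ socle A N ↔ (x : M) ∈ socle A M := by
  rw [h.mem_socle_iff, h.mem_socle_iff]
  exact forall₂_congr fun j _ => Subtype.ext_iff

theorem IsBasicFamily.isSimpleModule_socle_iff (h : IsBasicFamily f e) {N : Submodule A M} :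
    IsSimpleModule A (socle A N) ↔ (∃ x ∈ N, x ∈ socle A M ∧ x ≠ 0) ∧
      ∀ x ∈ N, ∀ y ∈ N, x ∈ socle A M → y ∈ socle A M → x ≠ 0 → ∃ a : A, a • x = y := by
  rw [isSimpleModule_iff_exists_smul_eq]
  refine and_congr ⟨?_, ?_⟩ ⟨?_, ?_⟩
  · rintro ⟨x, hx⟩
    exact ⟨x.1.1, x.1.2, h.mem_socle_submodule_iff.1 x.2,
      fun h0 => hx (Subtype.ext (Subtype.ext h0))⟩
  · rintro ⟨x, hN, hS, hx⟩
    exact ⟨⟨⟨x, hN⟩, h.mem_socle_submodule_iff.2 hS⟩, fun h0 =>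
      hx (congrArg (fun z : socle A N => (z : M)) h0)⟩
  · intro H x hx y hy hxS hyS hx0
    obtain ⟨a, ha⟩ := H ⟨⟨x, hx⟩, h.mem_socle_submodule_iff.2 hxS⟩
      ⟨⟨y, hy⟩, h.mem_socle_submodule_iff.2 hyS⟩
      (fun h0 => hx0 (congrArg (fun z : socle A N => (z : M)) h0))
    exact ⟨a, congrArg (fun z : socle A N => (z : M)) ha⟩
  · intro H x y hx
    obtain ⟨a, ha⟩ := H x.1.1 x.1.2 y.1.1 y.1.2 (h.mem_socle_submodule_iff.1 x.2)
      (h.mem_socle_submodule_iff.1 y.2) (fun h0 => hx (Subtype.ext (Subtype.ext h0)))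
    exact ⟨a, Subtype.ext (Subtype.ext ha)⟩

/-- The top of the cyclic module is simple and `ε` fixes its nonzero generator, so an isomorphism
exists exactly when the socle is simple and not killed by `ε`. -/
theorem IsBasicFamily.nonempty_socle_equiv_top_iff (h : IsBasicFamily f e) {N : Submodule A M}
    {ε : A} (hε : IsTopSimple ε) {c : M} (hc : ε • c = c) (hc0 : c ≠ 0) :
    Nonempty (socle A N ≃ₗ[A] Top A (Submodule.span A {c})) ↔
      (∃ x ∈ N, x ∈ socle A M ∧ ε • x ≠ 0) ∧
      ∀ x ∈ N, ∀ y ∈ N, x ∈ socle A M → y ∈ socle A M → x ≠ 0 → ∃ a : A, a • x = y := by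
  have hT := isSimpleModule_top_span hε hc hc0
  let c' : Submodule.span A {c} := ⟨c, Submodule.mem_span_singleton_self c⟩
  let t : Top A (Submodule.span A {c}) := Submodule.Quotient.mk c'
  have ht : ε • t = t := by
    rw [← Submodule.Quotient.mk_smul]; exact congrArg _ (Subtype.ext hc)
  have ht0 : t ≠ 0 := by
    intro h0
    obtain ⟨x, hx⟩ := (isSimpleModule_iff_exists_smul_eq.1 hT).1
    obtain ⟨x, rfl⟩ := Submodule.Quotient.mk_surjective _ x
    obtain ⟨a, ha⟩ := Submodule.mem_span_singleton.1 x.2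
    have : x = a • c' := Subtype.ext ha.symm
    apply hx
    rw [this, Submodule.Quotient.mk_smul]
    change a • t = 0
    rw [h0, smul_zero]
  constructor
  · rintro ⟨φ⟩
    have hS : IsSimpleModule A (socle A N) := IsSimpleModule.congr φ
    refine ⟨?_, (h.isSimpleModule_socle_iff.1 hS).2⟩
    refine ⟨φ.symm t, (φ.symm t).1.2, h.mem_socle_submodule_iff.1 (φ.symm t).2, fun h0 => ht0 ?_⟩
    have h1 : φ.symm (ε • t) = 0 := by
      rw [map_smul]; exact Subtype.ext (Subtype.ext h0)
    rwa [ht, LinearEquiv.map_eq_zero_iff] at h1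
  · rintro ⟨⟨x, hN, hS, hx⟩, H⟩
    have hS' : IsSimpleModule A (socle A N) := h.isSimpleModule_socle_iff.2
      ⟨⟨x, hN, hS, fun h0 => hx (by rw [h0, smul_zero])⟩, H⟩
    refine nonempty_equiv_of_smul_ne_zero hε
      (x := (⟨⟨x, hN⟩, h.mem_socle_submodule_iff.2 hS⟩ : socle A N)) (y := t) ?_ (by rwa [ht])
    exact fun h0 => hx (congrArg (fun z : socle A N => (z : M)) h0)

end BasicFamilyModules

/-! ### Length, atoms and coatoms under anti-isomorphisms -/

section Lattices

variable {A B : Type*} [Ring A] [Ring B] {T S : Type*} [AddCommGroup T] [Module A T]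
  [AddCommGroup S] [Module B S]

theorem length_eq_of_antiIso (Φ : Submodule A T ≃o (Submodule B S)ᵒᵈ) :
    Module.length A T = Module.length B S := by
  rw [← WithBot.coe_inj, Module.coe_length, Module.coe_length, Order.krullDim_eq_of_orderIso Φ,
    Order.krullDim_orderDual]

theorem length_eq_sum_range {ι : Type*} [Fintype ι] [DecidableEq ι] (p : ι → S →ₗ[B] S)
    (hs : ∀ x, ∑ i, p i x = x) (ho : ∀ i j x, p i (p j x) = if i = j then p i x else 0) :
    Module.length B S = ∑ i, Module.length B (LinearMap.range (p i)) := by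
  have E : S ≃ₗ[B] ((i : ι) → LinearMap.range (p i)) := LinearEquiv.ofBijective
    (LinearMap.pi fun i => (p i).rangeRestrict) ⟨fun x y hxy => by
      rw [← hs x, ← hs y]
      exact Finset.sum_congr rfl fun i _ => congrArg Subtype.val (congrFun hxy i), fun y => by
      refine ⟨∑ j, (y j : S), funext fun i => Subtype.ext ?_⟩
      change p i (∑ j, (y j : S)) = y i
      have hy : ∀ j, ∃ x, p j x = y j := fun j => (y j).2
      choose x hx using hy
      simp only [← hx, map_sum, ho]
      rw [Finset.sum_ite_eq]; simp⟩
  rw [E.length_eq, Module.length_pi_of_fintype]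

/-- The `m` nonzero summands have length at least one each and total length `m`, so none can be
longer. -/
theorem isSimpleModule_range_of_length {m : ℕ} (hm : Module.length B S = m) (p : Fin m → S →ₗ[B] S)
    (hs : ∀ x, ∑ i, p i x = x) (ho : ∀ i j x, p i (p j x) = if i = j then p i x else 0)
    (h0 : ∀ i, p i ≠ 0) (i : Fin m) : IsSimpleModule B (LinearMap.range (p i)) := by
  have h1 : ∀ i, 1 ≤ Module.length B (LinearMap.range (p i)) := fun i => by
    rw [Order.one_le_iff_ne_zero, Ne, Module.length_eq_zero_iff, Submodule.subsingleton_iff_eq_bot,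
      LinearMap.range_eq_bot]
    exact h0 i
  rw [← Module.length_eq_one_iff]
  refine le_antisymm ?_ (h1 i)
  have h2 := length_eq_sum_range p hs ho
  rw [hm, ← Finset.add_sum_erase _ _ (Finset.mem_univ i)] at h2
  have h3 := Finset.card_nsmul_le_sum (Finset.univ.erase i) _ 1 fun j _ => h1 j
  rw [Finset.card_erase_of_mem (Finset.mem_univ i), Finset.card_fin, nsmul_one] at h3
  have h4 := (add_le_add_right h3 (Module.length B (LinearMap.range (p i)))).trans_eq h2.symm
  have h5 : (m : ℕ∞) = 1 + ((m - 1 : ℕ) : ℕ∞) := by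
    have := i.pos
    norm_cast; omega
  rw [h5] at h4
  exact (ENat.add_le_add_iff_right (ENat.natCast_ne_top _)).1 h4

/-- The third atom is the graph `{x + φ x}` of the isomorphism. -/
theorem exists_third_atom {N K : Submodule B S} (hN : IsAtom N) (hK : IsAtom K) (hne : N ≠ K)
    (φ : N ≃ₗ[B] K) : ∃ C : Submodule B S, IsAtom C ∧ C ≤ N ⊔ K ∧ C ≠ N ∧ C ≠ K := by
  have hd : ∀ x, x ∈ N → x ∈ K → x = 0 := fun x h1 h2 =>
    (Submodule.disjoint_def.1 (hN.disjoint_of_ne hK hne)) x h1 h2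
  let g : N →ₗ[B] S := N.subtype + K.subtype ∘ₗ φ.toLinearMap
  have hg : ∀ x : N, g x = x + φ x := fun x => rfl
  have hgi : Function.Injective g := by
    rw [← LinearMap.ker_eq_bot, LinearMap.ker_eq_bot']
    intro x hx
    rw [hg] at hx
    refine Subtype.ext (hd x x.2 ?_)
    rw [eq_neg_of_add_eq_zero_left hx]
    exact neg_mem (φ x).2
  have hNs : IsSimpleModule B N := isSimpleModule_iff_isAtom.2 hN
  obtain ⟨x, hx⟩ := (isSimpleModule_iff_exists_smul_eq.1 hNs).1
  refine ⟨LinearMap.range g, isSimpleModule_iff_isAtom.1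
    (IsSimpleModule.congr (LinearEquiv.ofInjective g hgi).symm), ?_, fun h => hx ?_, fun h => hx ?_⟩
  · rintro _ ⟨y, rfl⟩
    exact Submodule.add_mem_sup y.2 (φ y).2
  · have h1 : g x ∈ N := h.le (LinearMap.mem_range_self g x)
    rw [hg, Submodule.add_mem_iff_right _ x.2] at h1
    have h2 : φ x = 0 := Subtype.ext (hd _ h1 (φ x).2)
    rwa [LinearEquiv.map_eq_zero_iff] at h2
  · have h1 : g x ∈ K := h.le (LinearMap.mem_range_self g x)
    rw [hg, Submodule.add_mem_iff_left _ (φ x).2] at h1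
    exact Subtype.ext (hd _ x.2 h1)

/-- By modularity `M₁` covers `M₁ ⊓ M₂`, and `M ⊓ M₁` lies between them without being `M₁`. -/
theorem inf_eq_inf_of_third_coatom {M₁ M₂ M : Submodule A T} (h₁ : IsCoatom M₁) (h₂ : IsCoatom M₂)
    (h : IsCoatom M) (hle : M₁ ⊓ M₂ ≤ M) (hne : M₁ ≠ M₂) (hne₁ : M ≠ M₁) : M ⊓ M₁ = M₁ ⊓ M₂ := by
  have hc : M₁ ⊓ M₂ ⋖ M₁ := by
    apply inf_covBy_of_covBy_sup_right
    rw [h₁.sup_eq_top_of_ne h₂ hne]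
    exact h₂.covBy_top
  refine (hc.eq_or_eq (le_inf hle inf_le_left) inf_le_right).resolve_right fun h0 => ?_
  exact hne₁ ((h₁.le_iff_eq h.1).1 (inf_eq_right.1 h0))

/-- Both quotients are isomorphic to `M / (M₁ ⊓ M₂)` by the second isomorphism theorem. -/
theorem quotient_equiv_of_third_coatom {M₁ M₂ M : Submodule A T} (h₁ : IsCoatom M₁)
    (h₂ : IsCoatom M₂) (h : IsCoatom M) (hle : M₁ ⊓ M₂ ≤ M) (hne : M₁ ≠ M₂) (hne₁ : M ≠ M₁)
    (hne₂ : M ≠ M₂) : Nonempty ((T ⧸ M₁) ≃ₗ[A] (T ⧸ M₂)) := by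
  have key : ∀ M' : Submodule A T, IsCoatom M' → M ≠ M' →
      Nonempty ((M ⧸ M'.comap M.subtype) ≃ₗ[A] (T ⧸ M')) := fun M' h' hM' => by
    have hs : Function.Surjective (M'.mkQ ∘ₗ M.subtype) := by
      rw [← LinearMap.range_eq_top, LinearMap.range_comp, Submodule.range_subtype,
        Submodule.map_mkQ_eq_top, h'.sup_eq_top_of_ne h hM'.symm]
    have hk : M'.comap M.subtype = LinearMap.ker (M'.mkQ ∘ₗ M.subtype) := by
      rw [LinearMap.ker_comp, Submodule.ker_mkQ]
    exact ⟨(Submodule.quotEquivOfEq _ _ hk).trans (LinearMap.quotKerEquivOfSurjective _ hs)⟩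
  have e1 := inf_eq_inf_of_third_coatom h₁ h₂ h hle hne hne₁
  have e2 := inf_eq_inf_of_third_coatom h₂ h₁ h (by rwa [inf_comm]) hne.symm hne₂
  have hk : M₁.comap M.subtype = M₂.comap M.subtype := by
    ext x
    have h1 := SetLike.ext_iff.1 (e1.trans ((inf_comm _ _).trans e2.symm)) (x : T)
    simpa [x.2] using h1
  obtain ⟨φ₁⟩ := key M₁ h₁ hne₁
  obtain ⟨φ₂⟩ := key M₂ h₂ hne₂
  exact ⟨(φ₁.symm.trans (Submodule.quotEquivOfEq _ _ hk)).trans φ₂⟩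

end Lattices

/-! ### Consequences of an anti-isomorphism between top and socle, for both sides at once -/

section Bimodules

variable {A B W : Type*} [Ring A] [Ring B] [AddCommGroup W] [Module A W] [Module B W]
  {m n : ℕ} {f : Fin m → A} {e : Fin n → A} {g : Fin m → B} {e' : Fin n → B}

theorem IsBasicFamily.smul_smul (h : IsBasicFamily f e) (i j : Fin m) (x : W) :
    f i • f j • x = if i = j then f i • x else 0 := by
  rw [← mul_smul, h.complete.mul_eq, ite_smul, zero_smul]

/-- If `W` has a generator `u` over `A` such that `a • u` lies in the radical only for `a` in the
radical of `A`, and on which `g i` acts as `f i`, then `W` has a top of length `m`. -/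
theorem length_top_eq [SMulCommClass B A W] (hf : IsBasicFamily f e) (hg : IsBasicFamily g e')
    {u : W} (hu : ∀ w : W, ∃ a : A, a • u = w)
    (hJ : ∀ a : A, a • u ∈ Module.jacobson A W ↔ a ∈ Ring.jacobson A)
    (hfg : ∀ i, g i • u = f i • u) : Module.length A (Top A W) = m := by
  let q : Fin m → W →ₗ[A] W := fun i => DistribSMul.toLinearMap A W (g i)
  let p : Fin m → Top A W →ₗ[A] Top A W := fun i =>
    (Module.jacobson A W).mapQ (Module.jacobson A W) (q i) (Module.le_comap_jacobson _)
  have hp : ∀ i (x : W), p i (Submodule.Quotient.mk x) = Submodule.Quotient.mk (g i • x) :=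
    fun i x => rfl
  -- In terms of the generator, the action of `g i` multiplies the coefficient by `f i` on the
  -- right; the range of `p i` thus plays the role of the top of `A fᵢ`.
  have hpu : ∀ i (a : A), p i (Submodule.Quotient.mk (a • u)) =
      Submodule.Quotient.mk ((a * f i) • u) := fun i a => by
    rw [hp, smul_comm, hfg, mul_smul]
  have hs : ∀ i, IsSimpleModule A (LinearMap.range (p i)) := fun i => by
    rw [isSimpleModule_iff_exists_smul_eq]
    constructor
    · refine ⟨⟨_, LinearMap.mem_range_self (p i) (Submodule.Quotient.mk ((1 : A) • u))⟩,
        fun h0 => (hf.topSimple i).notMem ?_⟩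
      have h1 := congrArg Subtype.val h0
      simp only [hpu] at h1
      have h2 := (hJ _).1 ((Submodule.Quotient.mk_eq_zero _).1 h1)
      rwa [one_mul] at h2
    · rintro ⟨_, x, rfl⟩ ⟨_, y, rfl⟩ hx
      obtain ⟨x, rfl⟩ := Submodule.Quotient.mk_surjective _ x
      obtain ⟨y, rfl⟩ := Submodule.Quotient.mk_surjective _ y
      obtain ⟨a, rfl⟩ := hu x
      obtain ⟨b, rfl⟩ := hu y
      have ha : a * f i ∉ Ring.jacobson A := fun h => hx (Subtype.ext (by
        change p i (Submodule.Quotient.mk (a • u)) = 0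
        rw [hpu]
        exact (Submodule.Quotient.mk_eq_zero _).2 ((hJ _).2 h)))
      obtain ⟨r, hr⟩ := (hf.topSimple i).exists_left a ha
      refine ⟨b * r, Subtype.ext ?_⟩
      change (b * r) • p i (Submodule.Quotient.mk (a • u)) = p i (Submodule.Quotient.mk (b • u))
      rw [hpu, hpu, ← Submodule.Quotient.mk_smul, ← mul_smul, mul_assoc b r, hr]
  rw [length_eq_sum_range p]
  · simp only [Module.length_eq_one, Finset.sum_const, Finset.card_univ, Fintype.card_fin,
      nsmul_one]
  · intro x
    obtain ⟨x, rfl⟩ := Submodule.Quotient.mk_surjective _ x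
    simp only [hp]
    conv_rhs => rw [← hg.sum_smul x]
    exact (map_sum (Module.jacobson A W).mkQ _ _).symm
  · intro i j x
    obtain ⟨x, rfl⟩ := Submodule.Quotient.mk_surjective _ x
    rw [hp, hp, hp, hg.smul_smul]
    split <;> rfl

/-- The socle inherits length `m` from the top and splits into the `m` nonzero pieces cut out by the
`f i`, so each piece is simple. -/
theorem exists_smul_eq_of_antiIso [SMulCommClass B A W] [SMulCommClass A B W]
    (hf : IsBasicFamily f e) (hg : IsBasicFamily g e')
    {u : W} (hu : ∀ w : W, ∃ a : A, a • u = w)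
    (hJ : ∀ a : A, a • u ∈ Module.jacobson A W ↔ a ∈ Ring.jacobson A)
    (hfg : ∀ i, g i • u = f i • u)
    (Φ : Submodule A (Top A W) ≃o (Submodule B (socle B W))ᵒᵈ)
    (hne : ∀ i, ∃ x ∈ socle B W, f i • x ≠ 0) (i : Fin m) {x y : W} (hx : x ∈ socle B W)
    (hy : y ∈ socle B W) (hfx : f i • x = x) (hfy : f i • y = y) (hx0 : x ≠ 0) :
    ∃ b : B, b • x = y := by
  have hmem : ∀ (a : A), ∀ z ∈ socle B W, DistribSMul.toLinearMap B W a z ∈ socle B W :=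
    fun a z hz => by
      rw [hg.mem_socle_iff] at hz ⊢
      intro j hj
      change j • a • z = 0
      rw [smul_comm, hz j hj, smul_zero]
  let p : Fin m → socle B W →ₗ[B] socle B W := fun i =>
    (DistribSMul.toLinearMap B W (f i)).restrict (hmem (f i))
  have hp : ∀ i z, (p i z : W) = f i • (z : W) := fun i z => rfl
  have hlen : Module.length B (socle B W) = m := by
    rw [← length_eq_of_antiIso Φ, length_top_eq hf hg hu hJ hfg]
  have hs := isSimpleModule_range_of_length hlen p
    (fun z => Subtype.ext (by
      rw [AddSubmonoidClass.coe_finsetSum]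
      exact hf.sum_smul (z : W)))
    (fun i j z => Subtype.ext (by
      rw [hp, hp, hf.smul_smul]
      split <;> rfl))
    (fun i h0 => by
      obtain ⟨z, hz, hz0⟩ := hne i
      exact hz0 (congrArg Subtype.val (LinearMap.congr_fun h0 ⟨z, hz⟩))) i
  obtain ⟨b, hb⟩ := (isSimpleModule_iff_exists_smul_eq.1 hs).2
    ⟨⟨x, hx⟩, ⟨x, hx⟩, Subtype.ext hfx⟩ ⟨⟨y, hy⟩, ⟨y, hy⟩, Subtype.ext hfy⟩
    (fun h0 => hx0 (congrArg (fun z : LinearMap.range (p i) => ((z : socle B W) : W)) h0))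
  exact ⟨b, congrArg (fun z : LinearMap.range (p i) => ((z : socle B W) : W)) hb⟩

/-- The top has zero radical, so some maximal submodule misses the nonzero class of `eₖu`. -/
theorem exists_coatom_smul_ne_zero (hf : IsBasicFamily f e) {u : W}
    (hJ : ∀ a : A, a • u ∈ Module.jacobson A W ↔ a ∈ Ring.jacobson A) (k : Fin n) :
    ∃ M : Submodule A (Top A W), IsCoatom M ∧ ∃ x : Top A W ⧸ M, e k • x ≠ 0 := by
  let t : Top A W := Submodule.Quotient.mk u
  have ht : e k • t ∉ Module.jacobson A (Top A W) := by
    rw [Module.jacobson_quotient_jacobson, Submodule.mem_bot, ← Submodule.Quotient.mk_smul,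
      Submodule.Quotient.mk_eq_zero, hJ]
    exact (hf.topSimple' k).notMem
  obtain ⟨M, hM, hMt⟩ : ∃ M : Submodule A (Top A W), IsCoatom M ∧ e k • t ∉ M := by
    by_contra! hn
    exact ht (Submodule.mem_sInf.2 fun M hM => hn M hM)
  refine ⟨M, hM, Submodule.Quotient.mk t, fun h0 => hMt ?_⟩
  rwa [← Submodule.Quotient.mk_smul, Submodule.Quotient.mk_eq_zero] at h0

/-- Pigeonhole: `t` sends the type `k` of a simple quotient of the top to the type of the
corresponding atom of the socle. Its injectivity rests on third atoms and third coatoms. -/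
theorem exists_mem_socle_smul_ne_zero_of_antiIso
    (hf : IsBasicFamily f e) (hg : IsBasicFamily g e') {u : W}
    (hJ : ∀ a : A, a • u ∈ Module.jacobson A W ↔ a ∈ Ring.jacobson A)
    (Φ : Submodule A (Top A W) ≃o (Submodule B (socle B W))ᵒᵈ) (j : Fin n) :
    ∃ x ∈ socle B W, e' j • x ≠ 0 := by
  choose M hM hMe using exists_coatom_smul_ne_zero hf hJ
  let N : Fin n → Submodule B (socle B W) := fun k => OrderDual.ofDual (Φ (M k))
  have hN : ∀ k, IsAtom (N k) := fun k => 
    isCoatom_dual_iff_isAtom.1 ((Φ.isCoatom_iff (M k)).2 (hM k))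
  have hNs : ∀ k, IsSimpleModule B (N k) := fun k => isSimpleModule_iff_isAtom.2 (hN k)
  have hMs : ∀ k, IsSimpleModule A (Top A W ⧸ M k) := fun k => isSimpleModule_iff_isCoatom.2 (hM k)
  have ht : ∀ k, ∃ (l : Fin n) (y : N k), e' l • y ≠ 0 := fun k => by
    obtain ⟨x, hx⟩ := (isSimpleModule_iff_exists_smul_eq.1 (hNs k)).1
    obtain ⟨l, b, hl⟩ := hg.exists_basic_smul_ne_zero hx
    exact ⟨l, _, hl⟩
  choose t y hy using ht
  have hinj : Function.Injective t := fun k l hkl => by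
    obtain ⟨φ⟩ := nonempty_equiv_of_smul_ne_zero (X := N k) (Y := N l) (x := y k) (y := y l)
      (hg.topSimple' (t k)) (hy k) (by rw [hkl]; exact hy l)
    obtain ⟨x, hx⟩ := hMe k
    obtain ⟨z, hz⟩ := hMe l
    have finish : Nonempty ((Top A W ⧸ M k) ≃ₗ[A] (Top A W ⧸ M l)) → k = l := fun ⟨ψ⟩ =>
      hf.eq_of_smul_ne_zero (y := ψ.symm z) hx (by
        rwa [← map_smul, Ne, LinearEquiv.map_eq_zero_iff])
    by_cases hMM : M k = M l
    · exact finish ⟨Submodule.quotEquivOfEq _ _ hMM⟩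
    have hNN : N k ≠ N l := fun h0 => hMM (Φ.injective (OrderDual.ofDual.injective h0))
    obtain ⟨C, hC, hle, hCk, hCl⟩ := exists_third_atom (hN k) (hN l) hNN φ
    have hΦC : Φ (Φ.symm (OrderDual.toDual C)) = OrderDual.toDual C := Φ.apply_symm_apply _
    refine finish (quotient_equiv_of_third_coatom (M := Φ.symm (OrderDual.toDual C)) (hM k) (hM l)
      ?_ ?_ hMM ?_ ?_)
    · exact (Φ.symm.isCoatom_iff _).2 hC.dual
    · rw [← Φ.le_iff_le, hΦC, map_inf]
      exact hle
    · intro h0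
      exact hCk (by change C = OrderDual.ofDual (Φ (M k)); rw [← h0, hΦC]; rfl)
    · intro h0
      exact hCl (by change C = OrderDual.ofDual (Φ (M l)); rw [← h0, hΦC]; rfl)
  obtain ⟨k, rfl⟩ := (Finite.injective_iff_surjective.1 hinj) j
  exact ⟨((y k : socle B W) : W), (y k : socle B W).2, fun h0 =>
    hy k (Subtype.ext (Subtype.ext h0))⟩

end Bimodules

/-! ### Simple socles: equality of the socles, the permutation, double annihilators -/

section NakayamaRings

variable {R : Type*} [Ring R] {m n : ℕ}

/-- `xJ(R) = 0`. -/
def RightKills (x : R) : Prop := ∀ j ∈ Ring.jacobson R, x * j = 0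

/-- `J(R)x = 0`. -/
def LeftKills (x : R) : Prop := ∀ j ∈ Ring.jacobson R, j * x = 0

theorem RightKills.mul_left {x : R} (h : RightKills x) (a : R) : RightKills (a * x) := fun j hj => by
  rw [mul_assoc, h j hj, mul_zero]

theorem RightKills.mul_right {x : R} (h : RightKills x) (a : R) : RightKills (x * a) := fun j hj => by
  rw [mul_assoc, h _ (mul_mem_jacobson_left hj a)]

theorem LeftKills.mul_right {x : R} (h : LeftKills x) (a : R) : LeftKills (x * a) := fun j hj => by
  rw [← mul_assoc, h j hj, zero_mul]

theorem LeftKills.mul_left {x : R} (h : LeftKills x) (a : R) : LeftKills (a * x) := fun j hj => by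
  rw [← mul_assoc, h _ (mul_mem_jacobson_right hj a)]

theorem rightKills_op_iff {x : Rᵐᵒᵖ} : RightKills x ↔ LeftKills x.unop :=
  ⟨fun h j hj => congrArg MulOpposite.unop (h (.op j) (op_mem_jacobson_iff.2 hj)),
    fun h j hj => MulOpposite.unop_injective (h j.unop (mem_jacobson_op_iff.1 hj))⟩

theorem leftKills_op_iff {x : Rᵐᵒᵖ} : LeftKills x ↔ RightKills x.unop :=
  ⟨fun h j hj => congrArg MulOpposite.unop (h (.op j) (op_mem_jacobson_iff.2 hj)),
    fun h j hj => MulOpposite.unop_injective (h j.unop (mem_jacobson_op_iff.1 hj))⟩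

theorem IsBasicFamily.mem_right_socle_iff {f : Fin m → R} {e : Fin n → R} (h : IsBasicFamily f e)
    {x : R} : x ∈ socle Rᵐᵒᵖ R ↔ RightKills x := by
  rw [h.op.mem_socle_iff]
  exact ⟨fun H j hj => H (.op j) (op_mem_jacobson_iff.2 hj),
    fun H j hj => H j.unop (mem_jacobson_op_iff.1 hj)⟩

theorem IsBasicFamily.mem_left_socle_iff {f : Fin m → R} {e : Fin n → R} (h : IsBasicFamily f e)
    {x : R} : x ∈ socle R R ↔ LeftKills x :=
  h.mem_socle_iff

/-- Every nonzero right ideal meets the right socle, and every nonzero left ideal meets the left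
socle. -/
structure HasEssentialSocles (R : Type*) [Ring R] : Prop where
  right : ∀ x : R, x ≠ 0 → ∃ r, x * r ≠ 0 ∧ RightKills (x * r)
  left : ∀ x : R, x ≠ 0 → ∃ r, r * x ≠ 0 ∧ LeftKills (r * x)

theorem HasEssentialSocles.op (h : HasEssentialSocles R) : HasEssentialSocles Rᵐᵒᵖ where
  right x hx := by
    obtain ⟨r, h0, h1⟩ := h.left x.unop ((MulOpposite.unop_ne_zero_iff x).2 hx)
    exact ⟨.op r, fun h2 => h0 (congrArg MulOpposite.unop h2), rightKills_op_iff.2 h1⟩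
  left x hx := by
    obtain ⟨r, h0, h1⟩ := h.right x.unop ((MulOpposite.unop_ne_zero_iff x).2 hx)
    exact ⟨.op r, fun h2 => h0 (congrArg MulOpposite.unop h2), leftKills_op_iff.2 h1⟩

/-- The right socle of each `eₖR` and the left socle of each `Reₖ` is zero or simple, and every
isomorphism type of simple modules occurs in the socles of `R`. -/
structure HasSimpleSocles (e : Fin n → R) : Prop where
  right : ∀ k x y, RightKills x → RightKills y → e k * x = x → e k * y = y → x ≠ 0 → ∃ r, x * r = y
  left : ∀ k x y, LeftKills x → LeftKills y → x * e k = x → y * e k = y → x ≠ 0 → ∃ r, r * x = y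
  exists_right : ∀ k, ∃ x, RightKills x ∧ x * e k ≠ 0
  exists_left : ∀ k, ∃ x, LeftKills x ∧ e k * x ≠ 0

theorem HasSimpleSocles.op {e : Fin n → R} (h : HasSimpleSocles e) :
    HasSimpleSocles (fun k => MulOpposite.op (e k)) where
  right k x y hx hy hkx hky hx0 := by
    obtain ⟨r, hr⟩ := h.left k x.unop y.unop (rightKills_op_iff.1 hx) (rightKills_op_iff.1 hy)
      (congrArg MulOpposite.unop hkx) (congrArg MulOpposite.unop hky)
      ((MulOpposite.unop_ne_zero_iff x).2 hx0)
    exact ⟨.op r, MulOpposite.unop_injective hr⟩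
  left k x y hx hy hkx hky hx0 := by
    obtain ⟨r, hr⟩ := h.right k x.unop y.unop (leftKills_op_iff.1 hx) (leftKills_op_iff.1 hy)
      (congrArg MulOpposite.unop hkx) (congrArg MulOpposite.unop hky)
      ((MulOpposite.unop_ne_zero_iff x).2 hx0)
    exact ⟨.op r, MulOpposite.unop_injective hr⟩
  exists_right k := by
    obtain ⟨x, hx, h0⟩ := h.exists_left k
    exact ⟨.op x, rightKills_op_iff.2 hx, fun h1 => h0 (congrArg MulOpposite.unop h1)⟩
  exists_left k := by
    obtain ⟨x, hx, h0⟩ := h.exists_right k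
    exact ⟨.op x, leftKills_op_iff.2 hx, fun h1 => h0 (congrArg MulOpposite.unop h1)⟩

variable {f : Fin m → R} {e : Fin n → R}

/-- Some nonzero element of the left socle of `Reₖ` has the form `ryeₖ` with `yJ = 0`. By simplicity
it generates that socle, so `J` kills all of it from the right. -/
theorem HasSimpleSocles.rightKills_of_leftKills (hs : HasSimpleSocles e) (hf : IsBasicFamily f e)
    (hE : HasEssentialSocles R) {x : R} (hx : LeftKills x) : RightKills x := by
  have key : ∀ k z, LeftKills z → z * e k = z → RightKills z := fun k z hz hzk => by
    obtain ⟨y, hy, hy0⟩ := hs.exists_right k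
    obtain ⟨r, hr0, hr⟩ := hE.left _ hy0
    obtain ⟨d, hd⟩ := hs.left k (r * (y * e k)) z hr hz
      (by rw [mul_assoc, mul_assoc, (hf.topSimple' k).idem]) hzk hr0
    rw [← hd]
    exact ((hy.mul_right _).mul_left _).mul_left _
  have hsum : x = ∑ i, x * f i := by rw [← Finset.mul_sum, hf.complete.complete, mul_one]
  intro j hj
  rw [hsum, Finset.sum_mul]
  refine Finset.sum_eq_zero fun i _ => ?_
  obtain ⟨k, a, b, hab⟩ := hf.exists_factor i
  have h1 := key k (x * a * e k) ((hx.mul_right _).mul_right _)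
    (by rw [mul_assoc, (hf.topSimple' k).idem])
  have h2 : x * f i = x * a * e k * b := by rw [← hab]; simp only [mul_assoc]
  rw [h2]
  exact h1.mul_right b j hj

theorem HasSimpleSocles.rightKills_iff_leftKills (hs : HasSimpleSocles e) (hf : IsBasicFamily f e)
    (hE : HasEssentialSocles R) {x : R} : RightKills x ↔ LeftKills x := by
  refine ⟨fun h => ?_, hs.rightKills_of_leftKills hf hE⟩
  exact rightKills_op_iff.1 (hs.op.rightKills_of_leftKills hf.op hE.op
    (x := .op x) (leftKills_op_iff.2 h))

theorem IsBasicFamily.exists_mul_basic_ne_zero (hf : IsBasicFamily f e) {x : R} (hx : x ≠ 0) :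
    ∃ k a, x * a * e k ≠ 0 := by
  obtain ⟨k, b, h⟩ := hf.op.exists_basic_smul_ne_zero (M := R) hx
  exact ⟨k, b.unop, h⟩

theorem HasSimpleSocles.exists_perm (hs : HasSimpleSocles e) (hf : IsBasicFamily f e)
    (hE : HasEssentialSocles R) :
    ∃ π : Equiv.Perm (Fin n), ∀ k, ∃ x, RightKills x ∧ x ≠ 0 ∧ e k * x = x ∧ x * e (π k) = x := by
  have h1 : ∀ k, ∃ j x, RightKills x ∧ x ≠ 0 ∧ e k * x = x ∧ x * e j = x := fun k => by
    have hk := hf.topSimple' k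
    obtain ⟨r, h0, hr⟩ := hE.right (e k) (fun h => hk.notMem (h ▸ zero_mem _))
    obtain ⟨j, a, ha⟩ := hf.exists_mul_basic_ne_zero h0
    refine ⟨j, _, (hr.mul_right a).mul_right (e j), ha, ?_, ?_⟩
    · simp only [← mul_assoc, hk.idem]
    · rw [mul_assoc, (hf.topSimple' j).idem]
  choose σ x hx hx0 hkx hxk using h1
  have hinj : Function.Injective σ := fun k l hkl => by
    obtain ⟨r, hr⟩ := hs.left (σ k) (x k) (x l) ((hs.rightKills_iff_leftKills hf hE).1 (hx k))
      ((hs.rightKills_iff_leftKills hf hE).1 (hx l)) (hxk k) (by rw [hkl, hxk l]) (hx0 k)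
    -- Here `x l = r * x k`, so `e l * r * e k` maps `x k` to `x l ≠ 0`; an element of the radical
    -- would kill `x k`.
    refine (hf.eq_of_notMem l k r fun hJ => hx0 l ?_).symm
    have h2 := (hs.rightKills_iff_leftKills hf hE).1 (hx k) _ hJ
    rwa [mul_assoc, hkx, mul_assoc, hr, hkx] at h2
  exact ⟨Equiv.ofBijective σ (Finite.injective_iff_bijective.1 hinj),
    fun k => ⟨x k, hx k, hx0 k, hkx k, hxk k⟩⟩

theorem HasSimpleSocles.right_family (hs : HasSimpleSocles e) (hf : IsBasicFamily f e) (i : Fin m)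
    {x y : R} (hx : RightKills x) (hy : RightKills y) (hix : f i * x = x) (hiy : f i * y = y)
    (hx0 : x ≠ 0) : ∃ r, x * r = y := by
  obtain ⟨k, a, b, hab⟩ := hf.exists_factor i
  have hk := (hf.topSimple' k).idem
  have h1 : ∀ z, f i * z = z → a * (e k * (b * z)) = z := fun z hz => by
    rw [← mul_assoc, ← mul_assoc, hab, hz]
  obtain ⟨r, hr⟩ := hs.right k (e k * (b * x)) (e k * (b * y)) ((hx.mul_left _).mul_left _)
    ((hy.mul_left _).mul_left _) (by rw [← mul_assoc, hk]) (by rw [← mul_assoc, hk])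
    (fun h0 => hx0 (by rw [← h1 x hix, h0, mul_zero]))
  refine ⟨r, ?_⟩
  rw [← h1 y hiy, ← hr, ← mul_assoc, h1 x hix]

theorem HasSimpleSocles.left_family (hs : HasSimpleSocles e) (hf : IsBasicFamily f e) (i : Fin m)
    {x y : R} (hx : LeftKills x) (hy : LeftKills y) (hix : x * f i = x) (hiy : y * f i = y)
    (hx0 : x ≠ 0) : ∃ r, r * x = y := by
  obtain ⟨r, hr⟩ := hs.op.right_family hf.op i (x := .op x) (y := .op y) (rightKills_op_iff.2 hx)
    (rightKills_op_iff.2 hy) (MulOpposite.unop_injective hix) (MulOpposite.unop_injective hiy)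
    (fun h => hx0 (congrArg MulOpposite.unop h))
  exact ⟨r.unop, congrArg MulOpposite.unop hr⟩

/-- `lr(N) = N` for left ideals `N` that contain the radical. -/
theorem HasSimpleSocles.mem_of_forall_mul_eq_zero (hs : HasSimpleSocles e) (hf : IsBasicFamily f e)
    {N : Submodule R R} (hN : Ring.jacobson R ≤ N) {y : R}
    (hy : ∀ x, (∀ a ∈ N, a * x = 0) → y * x = 0) : y ∈ N := by
  by_contra hyN
  have hss : IsSemisimpleModule R (R ⧸ N) := by
    refine IsSemisimpleModule.of_sSup_simples_eq_top ?_
    rw [eq_top_iff]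
    rintro x -
    refine hf.mem_socle_iff.2 fun j hj => ?_
    obtain ⟨x, rfl⟩ := Submodule.Quotient.mk_surjective _ x
    rw [← Submodule.Quotient.mk_smul, Submodule.Quotient.mk_eq_zero]
    exact hN (mul_mem_jacobson_right hj x)
  let q : R →ₗ[R] R ⧸ N := N.mkQ
  have hyq : q y ∉ Module.jacobson R (R ⧸ N) := by
    rw [IsSemisimpleModule.jacobson_eq_bot, Submodule.mem_bot]
    exact fun h => hyN ((Submodule.Quotient.mk_eq_zero _).1 h)
  -- A semisimple module has zero radical, so some simple quotient of `R/N` does not kill `y`.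
  obtain ⟨M, hM, hyM⟩ : ∃ M : Submodule R (R ⧸ N), IsCoatom M ∧ q y ∉ M := by
    by_contra! hn
    exact hyq (Submodule.mem_sInf.2 fun M hM => hn M hM)
  have hX : IsSimpleModule R ((R ⧸ N) ⧸ M) := isSimpleModule_iff_isCoatom.2 hM
  let p : R →ₗ[R] (R ⧸ N) ⧸ M := M.mkQ ∘ₗ q
  have hp : ∀ a, p a = a • p 1 := fun a => by rw [← map_smul, smul_eq_mul, mul_one]
  have hpy : p y ≠ 0 := fun h => hyM ((Submodule.Quotient.mk_eq_zero _).1 h)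
  obtain ⟨k, b, hb⟩ := hf.exists_basic_smul_ne_zero hpy
  -- This quotient is isomorphic to the left ideal `R(eₖs)`. The composite `R → R/N → R` is right
  -- multiplication by `φ (p 1)`, which `N` annihilates but `y` does not.
  obtain ⟨s, hs1, hs0⟩ := hs.exists_left k
  have hk := hf.topSimple' k
  have hY : IsSimpleModule R (Submodule.span R {e k * s}) :=
    isSimpleModule_span_singleton hk (by rw [smul_eq_mul, ← mul_assoc, hk.idem]) hs0
      (hs1.mul_left (e k))
  obtain ⟨φ⟩ := nonempty_equiv_of_smul_ne_zero hk hb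
    (y := (⟨e k * s, Submodule.mem_span_singleton_self _⟩ : Submodule.span R {e k * s}))
    (fun h => hs0 (by
      have h1 : e k * (e k * s) = 0 := congrArg Subtype.val h
      rwa [← mul_assoc, hk.idem] at h1))
  have hφ : ∀ a : R, ((φ (p a) : Submodule.span R {e k * s}) : R) = a * (φ (p 1) : R) := fun a => by
    rw [hp a, map_smul]; rfl
  have h1 := hy (φ (p 1)) fun a ha => by
    rw [← hφ]
    have : p a = 0 := by
      have : q a = 0 := (Submodule.Quotient.mk_eq_zero _).2 ha
      change M.mkQ (q a) = 0
      rw [this, map_zero]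
    rw [this, map_zero]; rfl
  rw [← hφ] at h1
  exact hpy (φ.map_eq_zero_iff.1 (Subtype.ext h1))

/-- `rl(K) = K` passes from `K` to `K + kR` for `k` in the socle of some `Rfᵢ`. -/
theorem HasSimpleSocles.mem_sup_of_forall_mul_eq_zero (hs : HasSimpleSocles e)
    (hf : IsBasicFamily f e) (hE : HasEssentialSocles R) {K : Submodule Rᵐᵒᵖ R}
    (hKS : ∀ x ∈ K, RightKills x)
    (hK : ∀ y, (∀ a, (∀ x ∈ K, a * x = 0) → a * y = 0) → y ∈ K) {i : Fin m} {k : R}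
    (hk : RightKills k) (hki : k * f i = k) {y : R}
    (hy : ∀ a, (∀ x ∈ K, a * x = 0) → a * k = 0 → a * y = 0) : y ∈ K ⊔ rightIdeal k := by
  have hiff : ∀ {x : R}, RightKills x ↔ LeftKills x := hs.rightKills_iff_leftKills hf hE
  have hyS : RightKills y := hiff.2 fun j hj =>
    hy j (fun x hx => hiff.1 (hKS x hx) j hj) (hiff.1 hk j hj)
  by_cases h : ∃ c, (∀ x ∈ K, c * x = 0) ∧ c * k ≠ 0
  · obtain ⟨c, hcK, hck⟩ := h
    obtain ⟨l, hl⟩ := hf.exists_smul_ne_zero hck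
    rw [smul_eq_mul] at hl
    have hll := (hf.topSimple l).idem
    -- Simplicity of the right socle of `f l R` yields `r` with `f_l c k r = f_l c y`, which makes
    -- `y - kr` the candidate for the component in `K`.
    obtain ⟨r, hr⟩ := hs.right_family hf l (x := f l * (c * k)) (y := f l * (c * y))
      ((hk.mul_left _).mul_left _) ((hyS.mul_left _).mul_left _) (by rw [← mul_assoc, hll])
      (by rw [← mul_assoc, hll]) hl
    have h1 : y - k * r ∈ K := hK _ fun a ha => by
      -- Simplicity of the left socle of `R fᵢ` gives `ak = d f_l c k`. So `a - d f_l c` annihilates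
      -- both `K` and `k`, hence `y`, and `ay = akr` follows.
      obtain ⟨d, hd⟩ := hs.left_family hf i (x := f l * (c * k)) (y := a * k)
        (hiff.1 ((hk.mul_left _).mul_left _)) (hiff.1 (hk.mul_left _))
        (by simp only [mul_assoc, hki]) (by rw [mul_assoc, hki]) hl
      have h2 := hy (a - d * (f l * c))
        (fun x hx => by rw [sub_mul, ha x hx, mul_assoc, mul_assoc, hcK x hx]; simp)
        (by rw [sub_mul, ← hd]; simp only [mul_assoc, sub_self])
      rw [sub_mul, sub_eq_zero] at h2
      rw [mul_sub, h2, ← mul_assoc a k r, ← hd, sub_eq_zero]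
      calc d * (f l * c) * y = d * (f l * (c * y)) := by simp only [mul_assoc]
        _ = d * (f l * (c * k)) * r := by rw [← hr]; simp only [mul_assoc]
    rw [← sub_add_cancel y (k * r)]
    exact Submodule.add_mem_sup h1 (mem_rightIdeal_iff.2 ⟨r, rfl⟩)
  · push Not at h
    exact Submodule.mem_sup_left (hK y fun a ha => hy a ha (h a ha))

/-- The right socle is a finite sum of the pieces `S_r ∩ fᵢR`, each zero or simple. Right ideals
inside it are therefore finitely generated, which permits induction on generators. -/
theorem HasSimpleSocles.isNoetherian_right_socle (hs : HasSimpleSocles e) (hf : IsBasicFamily f e) :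
    IsNoetherian Rᵐᵒᵖ (socle Rᵐᵒᵖ R) := by
  let S : Fin m → Submodule Rᵐᵒᵖ R := fun i => socle Rᵐᵒᵖ R ⊓ rightIdeal (f i)
  have hS : ∀ i, IsNoetherian Rᵐᵒᵖ (S i) := fun i => by
    have hidem := (hf.topSimple i).idem
    by_cases h0 : ∃ x ∈ S i, x ≠ 0
    · have : IsSimpleModule Rᵐᵒᵖ (S i) := by
        rw [isSimpleModule_iff_exists_smul_eq]
        obtain ⟨x, hx, hx0⟩ := h0
        refine ⟨⟨⟨x, hx⟩, fun h => hx0 (congrArg Subtype.val h)⟩, fun x y hx => ?_⟩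
        obtain ⟨r, hr⟩ := hs.right_family hf i (hf.mem_right_socle_iff.1 x.2.1)
          (hf.mem_right_socle_iff.1 y.2.1) ((mem_rightIdeal_iff_of_idem hidem).1 x.2.2)
          ((mem_rightIdeal_iff_of_idem hidem).1 y.2.2) (fun h => hx (Subtype.ext h))
        exact ⟨.op r, Subtype.ext hr⟩
      infer_instance
    · push Not at h0
      rw [(Submodule.eq_bot_iff _).2 h0]
      infer_instance
  have hle : socle Rᵐᵒᵖ R ≤ ⨆ i, S i := fun x hx => by
    have hsum : x = ∑ i, f i * x := by rw [← Finset.sum_mul, hf.complete.complete, one_mul]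
    rw [hsum]
    exact Submodule.sum_mem _ fun i _ => Submodule.mem_iSup_of_mem i
      ⟨hf.mem_right_socle_iff.2 ((hf.mem_right_socle_iff.1 hx).mul_left _),
        mem_rightIdeal_iff.2 ⟨x, rfl⟩⟩
  have := isNoetherian_iSup (M := S)
  exact isNoetherian_of_le hle

/-- `rl(K) = K` for right ideals `K` contained in the right socle. -/
theorem HasSimpleSocles.mem_of_forall_mul_eq_zero' (hs : HasSimpleSocles e) (hf : IsBasicFamily f e)
    (hE : HasEssentialSocles R) {K : Submodule Rᵐᵒᵖ R} (hK : K ≤ socle Rᵐᵒᵖ R) {y : R}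
    (hy : ∀ a, (∀ x ∈ K, a * x = 0) → a * y = 0) : y ∈ K := by
  classical
  have key : ∀ t : Finset R, (∀ k ∈ t, RightKills k ∧ ∃ i, k * f i = k) →
      ∀ y, (∀ a, (∀ x ∈ Submodule.span Rᵐᵒᵖ (t : Set R), a * x = 0) → a * y = 0) →
        y ∈ Submodule.span Rᵐᵒᵖ (t : Set R) := by
    intro t
    induction t using Finset.induction_on with
    | empty =>
      intro _ y hy
      have := hy 1 (fun x hx => by simpa using hx)
      rw [one_mul] at this
      rw [this]; exact zero_mem _
    | insert k t _ ih =>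
      intro ht y hy
      have ht' : ∀ k ∈ t, RightKills k ∧ ∃ i, k * f i = k :=
        fun k hk => ht k (Finset.mem_insert_of_mem hk)
      obtain ⟨hk, i, hki⟩ := ht k (Finset.mem_insert_self k t)
      have hspan : Submodule.span Rᵐᵒᵖ ((insert k t : Finset R) : Set R) =
          Submodule.span Rᵐᵒᵖ (t : Set R) ⊔ rightIdeal k := by
        rw [Finset.coe_insert, Submodule.span_insert, sup_comm]
      rw [hspan] at hy ⊢
      have hle : Submodule.span Rᵐᵒᵖ (t : Set R) ≤ socle Rᵐᵒᵖ R :=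
        Submodule.span_le.2 fun x hx => hf.mem_right_socle_iff.2 (ht' x hx).1
      refine hs.mem_sup_of_forall_mul_eq_zero hf hE (fun x hx => hf.mem_right_socle_iff.1 (hle hx))
        (ih ht') hk hki fun a ha hak => hy a fun x hx => ?_
      obtain ⟨u, hu, v, hv, rfl⟩ := Submodule.mem_sup.1 hx
      obtain ⟨r, rfl⟩ := mem_rightIdeal_iff.1 hv
      rw [mul_add, ha u hu, ← mul_assoc, hak, zero_mul, add_zero]
  have := hs.isNoetherian_right_socle hf
  obtain ⟨t, rfl⟩ := isNoetherian_submodule.1 this K hK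
  -- Each generator `k = ∑ k fᵢ` is split into the `k fᵢ`, as the inductive step needs generators in
  -- some `R fᵢ`.
  let t' : Finset R := (t ×ˢ Finset.univ).image fun q : R × Fin m => q.1 * f q.2
  have hspan : Submodule.span Rᵐᵒᵖ (t : Set R) = Submodule.span Rᵐᵒᵖ (t' : Set R) := by
    apply le_antisymm <;> rw [Submodule.span_le] <;> intro x hx
    · have hsum : x = ∑ i, x * f i := by rw [← Finset.mul_sum, hf.complete.complete, mul_one]
      rw [hsum]
      exact Submodule.sum_mem _ fun i _ => Submodule.subset_span
        (Finset.mem_image.2 ⟨(x, i), Finset.mem_product.2 ⟨hx, Finset.mem_univ i⟩, rfl⟩)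
    · obtain ⟨q, hq, rfl⟩ := Finset.mem_image.1 hx
      exact Submodule.smul_mem _ (MulOpposite.op (f q.2))
        (Submodule.subset_span (Finset.mem_product.1 hq).1)
  rw [hspan] at hy ⊢
  refine key t' (fun k hk => ?_) y hy
  obtain ⟨q, hq, rfl⟩ := Finset.mem_image.1 hk
  exact ⟨(hf.mem_right_socle_iff.1 (hK (Submodule.subset_span
    (Finset.mem_product.1 hq).1))).mul_right _, q.2, by rw [mul_assoc, (hf.topSimple q.2).idem]⟩

end NakayamaRings

/-! ### The anti-isomorphisms induced by annihilators -/

section AnnihilatorAntiIsos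

variable {R : Type*} [Ring R] {m n : ℕ} {f : Fin m → R} {e : Fin n → R}

/-- `rl(N) = N` for right ideals `N` that contain the radical. -/
theorem HasSimpleSocles.mem_of_forall_mul_eq_zero_right (hs : HasSimpleSocles e)
    (hf : IsBasicFamily f e) {N : Submodule Rᵐᵒᵖ R} (hN : Module.jacobson Rᵐᵒᵖ R ≤ N) {y : R}
    (hy : ∀ x, (∀ a ∈ N, x * a = 0) → x * y = 0) : y ∈ N := by
  let L : Rᵐᵒᵖ →ₗ[Rᵐᵒᵖ] R := (MulOpposite.opLinearEquiv Rᵐᵒᵖ).symm.toLinearMap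
  refine hs.op.mem_of_forall_mul_eq_zero hf.op (N := N.comap L) (y := .op y) (fun j hj => ?_)
    fun x hx => ?_
  · exact hN (mem_right_jacobson_iff.2 (mem_jacobson_op_iff.1 hj))
  · refine MulOpposite.unop_injective (hy x.unop fun a ha => ?_)
    exact congrArg MulOpposite.unop (hx (.op a) ha)

/-- `lr(K) = K` for left ideals `K` contained in the left socle. -/
theorem HasSimpleSocles.mem_of_forall_mul_eq_zero_left (hs : HasSimpleSocles e)
    (hf : IsBasicFamily f e) (hE : HasEssentialSocles R) {K : Submodule R R} (hK : K ≤ socle R R)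
    {y : R} (hy : ∀ a, (∀ x ∈ K, x * a = 0) → y * a = 0) : y ∈ K := by
  -- The left ideal `K`, seen as a right ideal of the opposite ring.
  let K' : Submodule Rᵐᵒᵖᵐᵒᵖ Rᵐᵒᵖ :=
    { carrier := {x | x.unop ∈ K}
      add_mem' := fun ha hb => K.add_mem ha hb
      zero_mem' := K.zero_mem
      smul_mem' := fun c x hx => K.smul_mem c.unop.unop hx }
  refine hs.op.mem_of_forall_mul_eq_zero' hf.op hE.op (K := K') (y := .op y) (fun x hx => ?_)
    fun a ha => ?_
  · exact hf.op.mem_right_socle_iff.2 (rightKills_op_iff.2 (hf.mem_left_socle_iff.1 (hK hx)))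
  · refine MulOpposite.unop_injective (hy a.unop fun x hx => ?_)
    exact congrArg MulOpposite.unop (ha (.op x) hx)

theorem HasSimpleSocles.exists_topSocleAntiIso (hs : HasSimpleSocles e) (hf : IsBasicFamily f e)
    (hE : HasEssentialSocles R) : ∃ φ : TopSocleAntiIso R, φ.IsInducedByAnnihilators := by
  let F : Submodule R (Top R R) → Submodule Rᵐᵒᵖ (socle Rᵐᵒᵖ R) := fun N =>
    (rightAnnihilator (N.comap (Module.jacobson R R).mkQ : Set R)).comap (socle Rᵐᵒᵖ R).subtype
  let G : Submodule Rᵐᵒᵖ (socle Rᵐᵒᵖ R) → Submodule R (Top R R) := fun K =>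
    (leftAnnihilator (K.map (socle Rᵐᵒᵖ R).subtype : Set R)).map (Module.jacobson R R).mkQ
  have hJN : ∀ N : Submodule R (Top R R), Ring.jacobson R ≤ N.comap (Module.jacobson R R).mkQ :=
    fun N => Submodule.le_comap_mkQ _ _
  have hKS : ∀ K : Submodule Rᵐᵒᵖ (socle Rᵐᵒᵖ R), K.map (socle Rᵐᵒᵖ R).subtype ≤ socle Rᵐᵒᵖ R :=
    fun K => Submodule.map_subtype_le _ _
  have hF : ∀ N, (F N).map (socle Rᵐᵒᵖ R).subtype =
      rightAnnihilator (N.comap (Module.jacobson R R).mkQ : Set R) := fun N => by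
    rw [Submodule.map_comap_subtype, inf_eq_right]
    -- Since `J ⊆ N`, the annihilator `r(N)` lies in `S_l`; equality of the socles places it in
    -- `S_r`.
    exact fun x hx => hf.mem_right_socle_iff.2
      ((hs.rightKills_iff_leftKills hf hE).2 fun j hj => hx j (hJN N hj))
  have hG : ∀ K, (G K).comap (Module.jacobson R R).mkQ =
      leftAnnihilator (K.map (socle Rᵐᵒᵖ R).subtype : Set R) := fun K => by
    rw [Submodule.comap_map_mkQ, sup_eq_right]
    exact fun j hj x hx => (hs.rightKills_iff_leftKills hf hE).1
      (hf.mem_right_socle_iff.1 (hKS K hx)) j hj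
  have hGF : ∀ N, G (F N) = N := fun N => by
    apply Submodule.comap_injective_of_surjective (Submodule.mkQ_surjective (Module.jacobson R R))
    rw [hG, hF]
    refine le_antisymm (fun y hy => ?_) fun y hy x hx => hx y hy
    exact hs.mem_of_forall_mul_eq_zero hf (hJN N) hy
  have hFG : ∀ K, F (G K) = K := fun K => by
    apply Submodule.map_injective_of_injective (Submodule.injective_subtype (socle Rᵐᵒᵖ R))
    rw [hF, hG]
    refine le_antisymm (fun y hy => ?_) fun y hy x hx => hx y hy
    exact hs.mem_of_forall_mul_eq_zero' hf hE (hKS K) hy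
  have hFanti : Antitone F := fun N N' h x hx y hy => hx y (h hy)
  have hGanti : Antitone G := fun K K' h =>
    Submodule.map_mono fun x hx y hy => hx y (Submodule.map_mono h hy)
  let φ : TopSocleAntiIso R :=
    { toFun := fun N => OrderDual.toDual (F N)
      invFun := fun K => G (OrderDual.ofDual K)
      left_inv := hGF
      right_inv := hFG
      map_rel_iff' := fun {N N'} =>
        ⟨fun h => by rw [← hGF N, ← hGF N']; exact hGanti h, fun h => hFanti h⟩ }
  exact ⟨φ, hF, hG⟩

theorem HasSimpleSocles.exists_socleTopAntiIso (hs : HasSimpleSocles e) (hf : IsBasicFamily f e)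
    (hE : HasEssentialSocles R) : ∃ ψ : SocleTopAntiIso R, ψ.IsInducedByAnnihilators := by
  let F : Submodule R (socle R R) → Submodule Rᵐᵒᵖ (Top Rᵐᵒᵖ R) := fun K =>
    (rightAnnihilator (K.map (socle R R).subtype : Set R)).map (Module.jacobson Rᵐᵒᵖ R).mkQ
  let G : Submodule Rᵐᵒᵖ (Top Rᵐᵒᵖ R) → Submodule R (socle R R) := fun N =>
    (leftAnnihilator (N.comap (Module.jacobson Rᵐᵒᵖ R).mkQ : Set R)).comap (socle R R).subtype
  have hJN : ∀ N : Submodule Rᵐᵒᵖ (Top Rᵐᵒᵖ R),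
      Module.jacobson Rᵐᵒᵖ R ≤ N.comap (Module.jacobson Rᵐᵒᵖ R).mkQ :=
    fun N => Submodule.le_comap_mkQ _ _
  have hKS : ∀ K : Submodule R (socle R R), K.map (socle R R).subtype ≤ socle R R :=
    fun K => Submodule.map_subtype_le _ _
  have hF : ∀ K, (F K).comap (Module.jacobson Rᵐᵒᵖ R).mkQ =
      rightAnnihilator (K.map (socle R R).subtype : Set R) := fun K => by
    rw [Submodule.comap_map_mkQ, sup_eq_right]
    exact fun j hj x hx => (hs.rightKills_iff_leftKills hf hE).2
      (hf.mem_left_socle_iff.1 (hKS K hx)) j (mem_right_jacobson_iff.1 hj)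
  have hG : ∀ N, (G N).map (socle R R).subtype =
      leftAnnihilator (N.comap (Module.jacobson Rᵐᵒᵖ R).mkQ : Set R) := fun N => by
    rw [Submodule.map_comap_subtype, inf_eq_right]
    exact fun x hx => hf.mem_left_socle_iff.2 ((hs.rightKills_iff_leftKills hf hE).1
      fun j hj => hx j (hJN N (mem_right_jacobson_iff.2 hj)))
  have hGF : ∀ K, G (F K) = K := fun K => by
    apply Submodule.map_injective_of_injective (Submodule.injective_subtype (socle R R))
    rw [hG, hF]
    refine le_antisymm (fun y hy => ?_) fun y hy x hx => hx y hy
    exact hs.mem_of_forall_mul_eq_zero_left hf hE (hKS K) hy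
  have hFG : ∀ N, F (G N) = N := fun N => by
    apply Submodule.comap_injective_of_surjective
      (Submodule.mkQ_surjective (Module.jacobson Rᵐᵒᵖ R))
    rw [hF, hG]
    refine le_antisymm (fun y hy => ?_) fun y hy x hx => hx y hy
    exact hs.mem_of_forall_mul_eq_zero_right hf (hJN N) hy
  have hFanti : Antitone F := fun K K' h =>
    Submodule.map_mono fun x hx y hy => hx y (Submodule.map_mono h hy)
  have hGanti : Antitone G := fun N N' h x hx y hy => hx y (h hy)
  let ψ : SocleTopAntiIso R :=
    { toFun := fun K => OrderDual.toDual (F K)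
      invFun := fun N => G (OrderDual.ofDual N)
      left_inv := hGF
      right_inv := hFG
      map_rel_iff' := fun {K K'} =>
        ⟨fun h => by rw [← hGF K, ← hGF K']; exact hGanti h, fun h => hFanti h⟩ }
  exact ⟨ψ, hF, hG⟩

end AnnihilatorAntiIsos

/-! ### Simple socles versus Nakayama permutations and anti-isomorphisms -/

section Characterizations

variable {R : Type*} [Ring R] {m n : ℕ} {f : Fin m → R} {e : Fin n → R}

theorem IsBasicFamily.hasEssentialSocles (hf : IsBasicFamily f e)
    (hr : IsEssential (socle Rᵐᵒᵖ R)) (hl : IsEssential (socle R R)) : HasEssentialSocles R where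
  right x hx := by
    obtain ⟨y, hy, hy0⟩ := (Submodule.ne_bot_iff _).1
      (hr (rightIdeal x) (by rwa [Ne, Submodule.span_singleton_eq_bot]))
    obtain ⟨r, rfl⟩ := mem_rightIdeal_iff.1 hy.2
    exact ⟨r, hy0, hf.mem_right_socle_iff.1 hy.1⟩
  left x hx := by
    obtain ⟨y, hy, hy0⟩ := (Submodule.ne_bot_iff _).1
      (hl (leftIdeal x) (by rwa [Ne, Submodule.span_singleton_eq_bot]))
    obtain ⟨r, rfl⟩ := Submodule.mem_span_singleton.1 hy.2
    exact ⟨r, hy0, hf.mem_left_socle_iff.1 hy.1⟩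

theorem IsTopSimple.ne_zero {ε : R} (h : IsTopSimple ε) : ε ≠ 0 := fun h0 =>
  h.notMem (h0 ▸ zero_mem _)

theorem IsBasicFamily.nonempty_right_socle_equiv_iff (hf : IsBasicFamily f e) (k j : Fin n) :
    Nonempty (socle Rᵐᵒᵖ (rightIdeal (e k)) ≃ₗ[Rᵐᵒᵖ] Top Rᵐᵒᵖ (rightIdeal (e j))) ↔
      (∃ x, RightKills x ∧ e k * x = x ∧ x * e j ≠ 0) ∧
      ∀ x y, RightKills x → RightKills y → e k * x = x → e k * y = y → x ≠ 0 → ∃ r, x * r = y := by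
  rw [hf.op.nonempty_socle_equiv_top_iff (hf.topSimple' j).op (hf.topSimple' j).idem
    (hf.topSimple' j).ne_zero]
  simp only [mem_rightIdeal_iff_of_idem (hf.topSimple' k).idem, hf.mem_right_socle_iff]
  constructor
  · rintro ⟨⟨x, h1, h2, h3⟩, H⟩
    exact ⟨⟨x, h2, h1, h3⟩, fun x y hx hy hkx hky hx0 =>
      (H x hkx y hky hx hy hx0).imp' MulOpposite.unop fun _ h => h⟩
  · rintro ⟨⟨x, h1, h2, h3⟩, H⟩
    exact ⟨⟨x, h2, h1, h3⟩, fun x hkx y hky hx hy hx0 =>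
      (H x y hx hy hkx hky hx0).imp' MulOpposite.op fun _ h => h⟩

theorem IsBasicFamily.nonempty_left_socle_equiv_iff (hf : IsBasicFamily f e) (k j : Fin n) :
    Nonempty (socle R (leftIdeal (e j)) ≃ₗ[R] Top R (leftIdeal (e k))) ↔
      (∃ x, LeftKills x ∧ x * e j = x ∧ e k * x ≠ 0) ∧
      ∀ x y, LeftKills x → LeftKills y → x * e j = x → y * e j = y → x ≠ 0 → ∃ r, r * x = y := by
  rw [hf.nonempty_socle_equiv_top_iff (hf.topSimple' k) (hf.topSimple' k).idem
    (hf.topSimple' k).ne_zero]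
  simp only [mem_leftIdeal_iff_of_idem (hf.topSimple' j).idem, hf.mem_left_socle_iff]
  constructor
  · rintro ⟨⟨x, h1, h2, h3⟩, H⟩
    exact ⟨⟨x, h2, h1, h3⟩, fun x y hx hy hkx hky hx0 => H x hkx y hky hx hy hx0⟩
  · rintro ⟨⟨x, h1, h2, h3⟩, H⟩
    exact ⟨⟨x, h2, h1, h3⟩, fun x hkx y hky hx hy hx0 => H x y hx hy hkx hky hx0⟩

theorem IsNakayamaPermutation.hasSimpleSocles {π : Equiv.Perm (Fin n)}
    (h : IsNakayamaPermutation e π) (hf : IsBasicFamily f e) : HasSimpleSocles e where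
  right k := ((hf.nonempty_right_socle_equiv_iff k _).1 (h k).1).2
  left k := by
    have := ((hf.nonempty_left_socle_equiv_iff _ _).1 (h (π.symm k)).2).2
    rwa [π.apply_symm_apply] at this
  exists_right k := by
    obtain ⟨x, hx, -, h0⟩ := ((hf.nonempty_right_socle_equiv_iff _ _).1 (h (π.symm k)).1).1
    rw [π.apply_symm_apply] at h0
    exact ⟨x, hx, h0⟩
  exists_left k := by
    obtain ⟨x, hx, -, h0⟩ := ((hf.nonempty_left_socle_equiv_iff _ _).1 (h k).2).1
    exact ⟨x, hx, h0⟩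

theorem HasSimpleSocles.exists_isNakayamaPermutation (hs : HasSimpleSocles e)
    (hf : IsBasicFamily f e) (hE : HasEssentialSocles R) :
    ∃ π : Equiv.Perm (Fin n), IsNakayamaPermutation e π := by
  obtain ⟨π, hπ⟩ := hs.exists_perm hf hE
  refine ⟨π, fun k => ?_⟩
  obtain ⟨x, hx, hx0, hkx, hxk⟩ := hπ k
  exact ⟨(hf.nonempty_right_socle_equiv_iff _ _).2 ⟨⟨x, hx, hkx, by rwa [hxk]⟩, hs.right k⟩,
    (hf.nonempty_left_socle_equiv_iff _ _).2
      ⟨⟨x, (hs.rightKills_iff_leftKills hf hE).1 hx, hxk, by rwa [hkx]⟩, hs.left (π k)⟩⟩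

/-- The bimodule results apply to `W = R` with generator `1`, on which left and right multiplication
by `fᵢ` agree: `φ` handles the right socle, and `ψ`, reversed, the left socle with the two actions
exchanged. -/
theorem IsBasicFamily.hasSimpleSocles_of_antiIsos (hf : IsBasicFamily f e)
    (hE : HasEssentialSocles R) (φ : TopSocleAntiIso R) (ψ : SocleTopAntiIso R) :
    HasSimpleSocles e := by
  have hJ : ∀ a : R, a • (1 : R) ∈ Module.jacobson R R ↔ a ∈ Ring.jacobson R := fun a => by
    rw [smul_eq_mul, mul_one]
  have hJ' : ∀ a : Rᵐᵒᵖ, a • (1 : R) ∈ Module.jacobson Rᵐᵒᵖ R ↔ a ∈ Ring.jacobson Rᵐᵒᵖ := fun a => by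
    rw [mem_right_jacobson_iff, mem_jacobson_op_iff, MulOpposite.smul_eq_mul_unop, one_mul]
  have hu : ∀ w : R, ∃ a : R, a • (1 : R) = w := fun w => ⟨w, mul_one w⟩
  have hu' : ∀ w : R, ∃ a : Rᵐᵒᵖ, a • (1 : R) = w := fun w => ⟨.op w, one_mul w⟩
  have hfg : ∀ i, MulOpposite.op (f i) • (1 : R) = f i • (1 : R) := fun i => by simp
  let ψ' : Submodule Rᵐᵒᵖ (Top Rᵐᵒᵖ R) ≃o (Submodule R (socle R R))ᵒᵈ :=
    (OrderIso.dualDual _).trans ψ.symm.dual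
  have hneR : ∀ i, ∃ x ∈ socle Rᵐᵒᵖ R, f i • x ≠ 0 := fun i => by
    obtain ⟨r, h0, h1⟩ := hE.right (f i) (hf.topSimple i).ne_zero
    exact ⟨f i * r, hf.mem_right_socle_iff.2 h1, by
      rwa [smul_eq_mul, ← mul_assoc, (hf.topSimple i).idem]⟩
  have hneL : ∀ i, ∃ x ∈ socle R R, MulOpposite.op (f i) • x ≠ 0 := fun i => by
    obtain ⟨r, h0, h1⟩ := hE.left (f i) (hf.topSimple i).ne_zero
    exact ⟨r * f i, hf.mem_left_socle_iff.2 h1, by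
      rwa [op_smul_eq_mul, mul_assoc, (hf.topSimple i).idem]⟩
  refine ⟨fun k x y hx hy hkx hky hx0 => ?_, fun k x y hx hy hkx hky hx0 => ?_, fun k => ?_,
    fun k => ?_⟩
  · obtain ⟨i, hi⟩ := hf.exists_eq k
    rw [hi] at hkx hky
    obtain ⟨b, hb⟩ := exists_smul_eq_of_antiIso hf hf.op hu hJ hfg φ hneR i
      (hf.mem_right_socle_iff.2 hx) (hf.mem_right_socle_iff.2 hy) hkx hky hx0
    exact ⟨b.unop, hb⟩
  · obtain ⟨i, hi⟩ := hf.exists_eq k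
    rw [hi] at hkx hky
    exact exists_smul_eq_of_antiIso hf.op hf hu' hJ' (fun i => (hfg i).symm) ψ' hneL i
      (hf.mem_left_socle_iff.2 hx) (hf.mem_left_socle_iff.2 hy) hkx hky hx0
  · obtain ⟨x, hx, h0⟩ := exists_mem_socle_smul_ne_zero_of_antiIso hf hf.op hJ φ k
    exact ⟨x, hf.mem_right_socle_iff.1 hx, h0⟩
  · obtain ⟨x, hx, h0⟩ := exists_mem_socle_smul_ne_zero_of_antiIso hf.op hf hJ' ψ' k
    exact ⟨x, hf.mem_left_socle_iff.1 hx, h0⟩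

end Characterizations

end SemiperfectRing

open SemiperfectRing
theorem mainTheorem2 {R : Type u} [Ring R] (hR : IsSemiperfectRing R)
    (hr : IsEssential (socle Rᵐᵒᵖ R)) (hl : IsEssential (socle R R))
    {n : ℕ} (e : Fin n → R) (he : IsBasicSet e) :
    ((∃ π : Equiv.Perm (Fin n), IsNakayamaPermutation e π) ↔
      Nonempty (TopSocleAntiIso R) ∧ Nonempty (SocleTopAntiIso R)) ∧
    (Nonempty (TopSocleAntiIso R) ∧ Nonempty (SocleTopAntiIso R) →
      (∃ φ : TopSocleAntiIso R, φ.IsInducedByAnnihilators) ∧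
      (∃ ψ : SocleTopAntiIso R, ψ.IsInducedByAnnihilators)) := by
  obtain ⟨m, f, hf⟩ := he.exists_isBasicFamily
  have hE := hf.hasEssentialSocles hr hl
  refine ⟨⟨?_, ?_⟩, ?_⟩
  · rintro ⟨π, hπ⟩
    have hs := hπ.hasSimpleSocles hf
    obtain ⟨φ, -⟩ := hs.exists_topSocleAntiIso hf hE
    obtain ⟨ψ, -⟩ := hs.exists_socleTopAntiIso hf hE
    exact ⟨⟨φ⟩, ⟨ψ⟩⟩
  · rintro ⟨⟨φ⟩, ⟨ψ⟩⟩
    exact (hf.hasSimpleSocles_of_antiIsos hE φ ψ).exists_isNakayamaPermutation hf hE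
  · rintro ⟨⟨φ⟩, ⟨ψ⟩⟩
    have hs := hf.hasSimpleSocles_of_antiIsos hE φ ψ
    exact ⟨hs.exists_topSocleAntiIso hf hE, hs.exists_socleTopAntiIso hf hE⟩
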